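/- Let $W=(W_t)_{t\in[0,1]}$ be a standard Brownian motion, and let $Y\in\{0,1\}$ be independent of $W$ with $\mathbb P(Y=i)=p_i$, where $p_0,p_1\in(0,1)$ and $p_0+p_1=1$. For $\mu_0,\mu_1\in\mathbb R$ and $\alpha>0$ let $X$ be the solution of $$dX_t=\mu_Y\,dt+\alpha\,dW_t,\quad t\in[0,1],\qquad X_0=0,$$ and write $\theta=(\mu_0,\mu_1,\alpha,p_0,p_1)$. Let $\mathcal R_\theta(g)=\mathbb P_\theta(g(X)\ne Y)$ be the risk of a classifier $g$. The Bayes classifier is $$g_\theta(X)=\mathbf 1_{\{\Phi_\theta(X)\ge 1/2\}},\qquad \Phi_\theta(X)=\frac{p_1e^{F_1(X)}}{p_0e^{F_0(X)}+p_1e^{F_1(X)}},\qquad F_i(X)=\frac{\mu_i}{\alpha^2}X_1-\frac{\mu_i^2}{2\alpha^2}.$$ The learning sample $\mathcal D_N$ consists of $N$ independent copies of $(\bar X,Y)$, where $\bar X=(X_{k/n})_{0\le k\le n}$. An empirical classifier $\widehat g$ is a measurable function of $\mathcal D_N$ and of a new discretely observed path $\bar X$, with values in $\{0,1\}$. It is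 of plug-in type if $\widehat g=g_{\widehat\theta}$ for some measurable estimator $\widehat\theta=(\widehat\mu_0,\widehat\mu_1,\widehat\alpha,\widehat p_0,\widehat p_1)$, a function of $\mathcal D_N$, with $\widehat\alpha>0$, $\widehat p_0,\widehat p_1\in[0,1]$ and $\widehat p_0+\widehat p_1=1$. For a set $\Theta$ of parameters and a class $\mathcal C$ of empirical classifiers put $$\mathcal M_{N,n}(\mathcal C,\Theta)=\inf_{\widehat g\in\mathcal C}\ \sup_{\theta\in\Theta}\ \mathbb E_\theta\big[\mathcal R_\theta(\widehat g)-\mathcal R_\theta(g_\theta)\big],$$ where the expectation is over $\mathcal D_N$. Suppose that $n\propto N$, that is, $aN\le n\le bN$ for fixed constants $0<a\le b$. (1) (Unknown $\alpha$.) Let $\Theta$ be the set of all $\theta$ with $\mu_0,\mu_1\in\mathbb R$, $\alpha>0$, $p_0,p_1\in(0,1)$, $p_0+p_1=1$. There exist constants $c,C>0$ such that for all $N\ge2$ and all such $n$, $$cN^{-1/2}\ \le\ \mathcal M_{N,n}(\text{all empirical classifiers},\Theta)\ \le\ \mathcal M_{N,n}(\text{plug-in classifiers},\Theta)\ \le\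 CN^{-1/2}\log N .$$ (2) (Known $\alpha$.) Fix $\alpha>0$, let $\Theta_\alpha$ be the set of $\theta\in\Theta$ with this value of $\alpha$, and consider the plug-in classifiers with $\widehat\alpha=\alpha$. There exist constants $c,C>0$ such that for all $N\ge1$ and all such $n$, $$cN^{-1/2}\ \le\ \mathcal M_{N,n}(\text{all empirical classifiers},\Theta_\alpha)\ \le\ \mathcal M_{N,n}(\text{plug-in classifiers},\Theta_\alpha)\ \le\ CN^{-1/2}.$$ -/

import Mathlib

open MeasureTheory ProbabilityTheory
open scoped NNReal

noncomputable section

namespace ConstDiffusion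

/-- Parameters `θ = (μ₀, μ₁, α, (p₀, p₁))` of the mixture model `dX_t = μ_Y dt + α dW_t`,
`X_0 = 0`, with `P(Y = i) = p_i`. -/
structure Param where
  mu : Fin 2 → ℝ
  alpha : ℝ
  p : Fin 2 → ℝ

/-- The parameter set: `μ₀, μ₁ ∈ ℝ`, `α > 0`, and `(p₀, p₁) ∈ (0,1)²` a probability vector. -/
def paramSet : Set Param :=
  {θ | 0 < θ.alpha ∧ (∀ i, θ.p i ∈ Set.Ioo (0 : ℝ) 1) ∧ θ.p 0 + θ.p 1 = 1}

/-- The values that an estimator of the parameter may take. The estimated label frequencies may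
vanish, as the empirical ones do when a class is not represented in the sample. -/
def estimateSet : Set Param :=
  {θ | 0 < θ.alpha ∧ (∀ i, θ.p i ∈ Set.Icc (0 : ℝ) 1) ∧ θ.p 0 + θ.p 1 = 1}

/-- The log-likelihood ratio
`F_i(X) = ∫₀¹ (μ_i / α²) dX_s - (1/2) ∫₀¹ (μ_i² / α²) ds` as a function of `x = X_1`. -/
def score (θ : Param) (i : Fin 2) (x : ℝ) : ℝ :=
  θ.mu i / θ.alpha ^ 2 * x - θ.mu i ^ 2 / (2 * θ.alpha ^ 2)

/-- The regression function `Φ_θ(X) = P(Y = 1 | X)`, as a function of `x = X_1`. -/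
def regression (θ : Param) (x : ℝ) : ℝ :=
  θ.p 1 * Real.exp (score θ 1 x) /
    (θ.p 0 * Real.exp (score θ 0 x) + θ.p 1 * Real.exp (score θ 1 x))

/-- The classifier `g_θ(X) = 1_{Φ_θ(X) ≥ 1/2}`, as a function of `x = X_1`. -/
def classify (θ : Param) (x : ℝ) : Fin 2 :=
  if 1 / 2 ≤ regression θ x then 1 else 0

/-- The law of the label: `P(Y = i) = p_i`. -/
def labelLaw (θ : Param) : Measure (Fin 2) :=
  ∑ i, ENNReal.ofReal (θ.p i) • Measure.dirac i

/-- A discretely observed path `(X_{k/n})_{0 ≤ k ≤ n}`. -/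
abbrev Obs (n : ℕ) : Type := Fin (n + 1) → ℝ

/-- Values of the learning sample `((X̄¹, Y₁), …, (X̄ᴺ, Y_N))`. -/
abbrev Sample (N n : ℕ) : Type := Fin N → Obs n × Fin 2

/-- The values of a path at the times `k/n`, `0 ≤ k ≤ n`. -/
def discretize (n : ℕ) (x : ℝ≥0 → ℝ) : Obs n :=
  fun k => x ((k : ℕ) / (n : ℝ≥0))

section Model

variable {Ω : Type*} [MeasurableSpace Ω] (P : Measure Ω) (W : ℝ≥0 → Ω → ℝ)

/-- The joint law of the noise and of the label, which are independent. An outcome is a pair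
`(ω, i)`, and the label `Y` is the second coordinate. -/
def modelMeasure (θ : Param) : Measure (Ω × Fin 2) :=
  P.prod (labelLaw θ)

/-- The solution `X_t = ∫₀ᵗ μ_Y ds + ∫₀ᵗ α dW_s = μ_Y t + α W_t` of `dX_t = μ_Y dt + α dW_t`,
`X_0 = 0`. -/
def path (θ : Param) (z : Ω × Fin 2) (t : ℝ≥0) : ℝ :=
  θ.mu z.2 * t + θ.alpha * W t z.1

/-- The classification risk `R(g) = P(g(X) ≠ Y)` of a classifier `g` of paths. -/
def risk (θ : Param) (g : (ℝ≥0 → ℝ) → Fin 2) : ℝ :=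
  (modelMeasure P θ).real {z | g (path W θ z) ≠ z.2}

/-- The Bayes classifier `g* = g_θ` of paths. -/
def bayes (θ : Param) : (ℝ≥0 → ℝ) → Fin 2 :=
  fun x => classify θ (x 1)

/-- The law of one observation `(X̄, Y)`. -/
def obsLaw (n : ℕ) (θ : Param) : Measure (Obs n × Fin 2) :=
  (modelMeasure P θ).map fun z => (discretize n (path W θ z), z.2)

/-- The law of the learning sample: `N` independent copies of `(X̄, Y)`. -/
def sampleLaw (N n : ℕ) (θ : Param) : Measure (Sample N n) :=
  Measure.pi fun _ => obsLaw P W n θ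

/-- An empirical classification rule: it takes the learning sample and a new discretely observed
path, and predicts the label of that path. -/
abbrev Rule (N n : ℕ) : Type := Sample N n → Obs n → Fin 2

/-- The average excess risk `E[R(ĝ) - R(g*)]`, the expectation being over the learning sample. -/
def excessRisk (N n : ℕ) (θ : Param) (g : Rule N n) : ℝ :=
  ∫ D, (risk P W θ (fun x => g D (discretize n x)) - risk P W θ (bayes θ)) ∂(sampleLaw P W N n θ)

/-- The minimax excess risk `inf_ĝ sup_{θ ∈ Θ} E_θ[R(ĝ) - R(g_θ)]` over a class of rules,
computed in the complete lattice of extended reals. -/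
def minimaxExcessRisk (N n : ℕ) (rules : Set (Rule N n)) (Θ : Set Param) : EReal :=
  ⨅ g ∈ rules, ⨆ θ ∈ Θ, (excessRisk P W N n θ g : EReal)

end Model

/-- All (jointly measurable) empirical classification rules. -/
def allRules (N n : ℕ) : Set (Rule N n) :=
  {g | Measurable (Function.uncurry g)}

/-- A measurable estimator, with values in `T`, of the parameter from the learning sample. -/
structure IsEstimator {N n : ℕ} (T : Set Param) (est : Sample N n → Param) : Prop where
  mem : ∀ D, est D ∈ T
  measurable_mu : ∀ i, Measurable fun D => (est D).mu i
  measurable_alpha : Measurable fun D => (est D).alpha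
  measurable_p : ∀ i, Measurable fun D => (est D).p i

/-- The plug-in rules `ĝ = g_θ̂`, with `θ̂` any measurable estimator with values in `T`. The
last observation of a path is its value at time `1`. -/
def plugInRules (N n : ℕ) (T : Set Param) : Set (Rule N n) :=
  {g | ∃ est : Sample N n → Param, IsEstimator T est ∧
    ∀ D x, g D x = classify (est D) (x (Fin.last n))}

end ConstDiffusion

end

/-!
The rate is `N ^ (-1/2)` for both classes of parameters; in particular the logarithm in the upper
bound for an unknown diffusion coefficient is not needed.

*Upper bound.* All classifiers in play depend on the path through `X_1` only, and given `Y = i` the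
law of `X_1` is Gaussian with mean `μ_i` and standard deviation `α`. Since `g_θ̂` is the best
classifier in the model `θ̂` (`endRisk_oneSet_le`), its excess risk in the model `θ` is at most twice
the uniform distance between the two risk functionals (`endRisk_sub_le`), hence is controlled by
`∑ i, (|p̂_i - p_i| + p_i * d_i)`, where `d_i` is the total variation distance between the Gaussian
laws of the class `i`. This distance is at most
`min 1 (2 |μ̂_i - μ_i| / α + |α̂² / α² - 1|)` (`abs_normalLaw_sub_le`), a bound that is invariant under
the scaling of the model, so that unbounded parameters cause no loss. For empirical means,
`p̂_i (μ̂_i - μ_i) / α` is an average of `N` independent centred variables of variance `p_i`, and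
replacing `p_i` by `p̂_i` in front of `d_i` costs only `|p̂_i - p_i|` (`mul_min_one_le`); thus rare
classes are harmless, and every error is an average of independent centred variables with bounded
variance. When `α` is unknown it is estimated by the squared second differences of the paths at
their first three observation times, which do not depend on the drift
(`integral_abs_quadVar_le`). This requires `n ≥ 2`; otherwise `N ≤ n / a ≤ 1 / a` is bounded and so
is the excess risk.

*Lower bound.* If `μ_0 = μ_1 = 0`, the path carries no information on the label, and the problem is
to decide which label is more likely. For `p_1 = 1/2 ± ε` with `ε = 1 / (4 √N)`, the likelihood
ratios `L₊`, `L₋` of the samples with respect to `p_1 = 1/2` satisfy `L₊ L₋ = (1 - 4 ε²) ^ N ≥ 3/4`,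
which bounds the integral of `min L₊ L₋` away from `0` (`mul_tangent_le`). A wrong decision costs
`2 ε` (`le_excessRisk_add_excessRisk`).
-/

namespace ConstDiffusion

/-! ### Total variation distance between Gaussian laws -/

/-- The Gaussian law with mean `m` and standard deviation `s` (with variance `s ^ 2`). -/
noncomputable def normalLaw (m s : ℝ) : Measure ℝ := gaussianReal m (s ^ 2).toNNReal

/-- The density of `normalLaw m s`, for `s > 0`. -/
noncomputable def normalPDF (m s x : ℝ) : ℝ := gaussianPDFReal m (s ^ 2).toNNReal x

instance (m s : ℝ) : IsProbabilityMeasure (normalLaw m s) := by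
  unfold normalLaw; infer_instance

lemma toNNReal_sq_ne_zero {s : ℝ} (hs : 0 < s) : (s ^ 2).toNNReal ≠ 0 := by
  simpa using hs.ne'

lemma normalPDF_eq {s : ℝ} (hs : 0 < s) (m x : ℝ) :
    normalPDF m s x = (√(2 * Real.pi) * s)⁻¹ * Real.exp (-(x - m) ^ 2 / (2 * s ^ 2)) := by
  rw [normalPDF, gaussianPDFReal_def]
  simp only [Real.coe_toNNReal _ (sq_nonneg s)]
  rw [Real.sqrt_mul (by positivity), Real.sqrt_sq hs.le]

lemma normalPDF_nonneg (m s x : ℝ) : 0 ≤ normalPDF m s x := gaussianPDFReal_nonneg _ _ _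

lemma measurable_normalPDF (m s : ℝ) : Measurable (normalPDF m s) :=
  measurable_gaussianPDFReal _ _

lemma integrable_normalPDF (m s : ℝ) : Integrable (normalPDF m s) :=
  integrable_gaussianPDFReal _ _

lemma normalLaw_real_eq {s : ℝ} (hs : 0 < s) (m : ℝ) (A : Set ℝ) :
    (normalLaw m s).real A = ∫ x in A, normalPDF m s x := by
  rw [Measure.real, normalLaw, gaussianReal_apply_eq_integral _ (toNNReal_sq_ne_zero hs),
    ENNReal.toReal_ofReal]
  · rfl
  · exact integral_nonneg fun x => gaussianPDFReal_nonneg _ _ _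

lemma integral_normalLaw {s : ℝ} (hs : 0 < s) (m : ℝ) (f : ℝ → ℝ) :
    ∫ x, f x ∂(normalLaw m s) = ∫ x, normalPDF m s x * f x := by
  simpa using! integral_gaussianReal_eq_integral_smul (μ := m) (f := f) (toNNReal_sq_ne_zero hs)

lemma integral_normalLaw_sub_sq (m s : ℝ) :
    ∫ x, (x - m) ^ 2 ∂(normalLaw m s) = s ^ 2 := by
  have h := variance_fun_id_gaussianReal (μ := m) (v := (s ^ 2).toNNReal)
  rw [variance_eq_integral (by fun_prop)] at h
  simpa [normalLaw, Real.coe_toNNReal _ (sq_nonneg s)] using h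

lemma integrable_normalLaw_sub_sq (m s : ℝ) :
    Integrable (fun x => (x - m) ^ 2) (normalLaw m s) := by
  have h : MemLp (fun x : ℝ => x) 2 (normalLaw m s) := memLp_id_gaussianReal 2
  exact (h.sub (memLp_const m)).integrable_sq

/-- A bound on the change of a Gaussian law when its mean is shifted: `f - g ≤ f |log (f / g)|` for
positive densities `f` and `g`, and the log-likelihood ratio is here an affine function. -/
lemma normalLaw_shift_le_add_sq {s : ℝ} (hs : 0 < s) (m m' : ℝ) (A : Set ℝ) :
    (normalLaw m s).real A - (normalLaw m' s).real A
      ≤ |m - m'| / s + (|m - m'| / s) ^ 2 / 2 := by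
  set d := |m - m'| with hd
  set w : ℝ → ℝ := fun x => d / s ^ 2 * (((x - m) ^ 2 / s + s) / 2) + d ^ 2 / (2 * s ^ 2) with hw
  have hwi : Integrable w (normalLaw m s) :=
    (((((integrable_normalLaw_sub_sq m s).div_const s).add (integrable_const s)).div_const
      2).const_mul _).add (integrable_const _)
  have hwint : ∫ x, w x ∂(normalLaw m s) = d / s + (d / s) ^ 2 / 2 := by
    rw [hw, integral_add, integral_const_mul, integral_div, integral_add, integral_div,
      integral_normalLaw_sub_sq]
    · simp
      field_simp
      ring
    · exact (integrable_normalLaw_sub_sq m s).div_const s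
    · exact integrable_const s
    · exact ((((integrable_normalLaw_sub_sq m s).div_const s).add (integrable_const s)).div_const
        2).const_mul _
    · exact integrable_const _
  have hpt : ∀ x, normalPDF m s x - normalPDF m' s x ≤ normalPDF m s x * w x := by
    intro x
    set u := (m - m') * (2 * (x - m) + (m - m')) / (2 * s ^ 2) with hu
    have h1 : normalPDF m' s x = normalPDF m s x * Real.exp (-u) := by
      rw [normalPDF_eq hs, normalPDF_eq hs, mul_assoc, ← Real.exp_add]
      congr 2
      rw [hu]
      field_simp
      ring
    have h2 : 1 - Real.exp (-u) ≤ u := by linarith [Real.add_one_le_exp (-u)]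
    have h3 : u ≤ w x := by
      have h4 : |x - m| ≤ ((x - m) ^ 2 / s + s) / 2 := by
        have h5 : 0 ≤ (|x - m| - s) ^ 2 / s := by positivity
        have h6 : (|x - m| - s) ^ 2 / s = (x - m) ^ 2 / s + s - 2 * |x - m| := by
          field_simp
          rw [sub_sq, sq_abs]; ring
        linarith
      have h7 : u ≤ d / s ^ 2 * |x - m| + d ^ 2 / (2 * s ^ 2) := by
        have h8 : (m - m') * (x - m) ≤ d * |x - m| := by
          rw [hd, ← abs_mul]; exact le_abs_self _
        have h9 : d ^ 2 = (m - m') ^ 2 := by rw [hd, sq_abs]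
        have h10 : u = ((m - m') * (x - m)) / s ^ 2 + (m - m') ^ 2 / (2 * s ^ 2) := by
          rw [hu]; field_simp
        rw [h10, h9, div_mul_eq_mul_div]
        gcongr
      have hd0 : 0 ≤ d / s ^ 2 := by positivity
      simp only [hw]
      nlinarith [mul_le_mul_of_nonneg_left h4 hd0]
    calc normalPDF m s x - normalPDF m' s x = normalPDF m s x * (1 - Real.exp (-u)) := by
          rw [h1]; ring
      _ ≤ _ := mul_le_mul_of_nonneg_left (h2.trans h3) (normalPDF_nonneg _ _ _)
  have hint : Integrable (fun x => normalPDF m s x * w x) := by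
    have := hwi
    rw [normalLaw, gaussianReal_of_var_ne_zero _ (toNNReal_sq_ne_zero hs),
      integrable_withDensity_iff_integrable_smul' (measurable_gaussianPDF _ _)
        (ae_of_all _ fun x => gaussianPDF_lt_top)] at this
    simpa [toReal_gaussianPDF] using! this
  have hw0 : ∀ x, 0 ≤ w x := fun x => by simp only [hw]; positivity
  rw [normalLaw_real_eq hs, normalLaw_real_eq hs, ← integral_sub
    (integrable_normalPDF _ _).integrableOn (integrable_normalPDF _ _).integrableOn]
  calc ∫ x in A, (normalPDF m s x - normalPDF m' s x)
      ≤ ∫ x in A, normalPDF m s x * w x :=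
        integral_mono ((integrable_normalPDF _ _).sub (integrable_normalPDF _ _)).integrableOn
          hint.integrableOn hpt
    _ ≤ ∫ x, normalPDF m s x * w x :=
        setIntegral_le_integral hint
          (ae_of_all _ fun x => mul_nonneg (normalPDF_nonneg _ _ _) (hw0 x))
    _ = _ := by rw [← integral_normalLaw hs, hwint]

lemma abs_normalLaw_shift_le {s : ℝ} (hs : 0 < s) (m m' : ℝ) (A : Set ℝ) :
    |(normalLaw m s).real A - (normalLaw m' s).real A| ≤ 2 * (|m - m'| / s) := by
  have h1 := normalLaw_shift_le_add_sq hs m m' A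
  have h2 := normalLaw_shift_le_add_sq hs m' m A
  rw [abs_sub_comm m' m] at h2
  have h3 : (normalLaw m s).real A ≤ 1 := measureReal_le_one
  have h4 : (normalLaw m' s).real A ≤ 1 := measureReal_le_one
  have h5 : 0 ≤ (normalLaw m s).real A := measureReal_nonneg
  have h6 : 0 ≤ (normalLaw m' s).real A := measureReal_nonneg
  set d := |m - m'| / s
  have hd : 0 ≤ d := by positivity
  rcases le_total d 1 with h | h
  · rw [abs_le]; constructor <;> nlinarith
  · rw [abs_le]; constructor <;> linarith

/-- A bound on the change of a Gaussian law when its standard deviation is changed: the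
unnormalized densities are monotone in the standard deviation. -/
lemma normalLaw_scale_le_of_le {s t : ℝ} (ht : 0 < t) (hts : t ≤ s) (m : ℝ) {A : Set ℝ}
    (hA : MeasurableSet A) :
    |(normalLaw m s).real A - (normalLaw m t).real A| ≤ (s - t) / s := by
  have hs : 0 < s := ht.trans_le hts
  have key : ∀ B : Set ℝ, MeasurableSet B →
      (normalLaw m t).real B - (normalLaw m s).real B ≤ (s - t) / s := by
    intro B hB
    have h1 : t / s * (normalLaw m t).real B ≤ (normalLaw m s).real B := by
      rw [normalLaw_real_eq hs, normalLaw_real_eq ht, ← integral_const_mul]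
      refine integral_mono ((integrable_normalPDF _ _).const_mul _).integrableOn
        (integrable_normalPDF _ _).integrableOn fun x => ?_
      simp only [normalPDF_eq hs, normalPDF_eq ht]
      have h2 : -(x - m) ^ 2 / (2 * t ^ 2) ≤ -(x - m) ^ 2 / (2 * s ^ 2) := by
        rw [neg_div, neg_div, neg_le_neg_iff]
        gcongr
      calc t / s * ((√(2 * Real.pi) * t)⁻¹ * Real.exp (-(x - m) ^ 2 / (2 * t ^ 2)))
          = (√(2 * Real.pi) * s)⁻¹ * Real.exp (-(x - m) ^ 2 / (2 * t ^ 2)) := by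
            field_simp
        _ ≤ _ := by gcongr
    have h3 : (normalLaw m t).real B ≤ 1 := measureReal_le_one
    have h4 : 0 ≤ 1 - t / s := by rw [sub_nonneg, div_le_one hs]; exact hts
    have h5 : (s - t) / s = 1 - t / s := by field_simp
    rw [h5]
    nlinarith
  rw [abs_le]
  constructor
  · linarith [key A hA]
  · have := key Aᶜ hA.compl
    rw [probReal_compl_eq_one_sub hA, probReal_compl_eq_one_sub hA] at this
    linarith

lemma abs_normalLaw_scale_le {s t : ℝ} (hs : 0 < s) (ht : 0 < t) (m : ℝ) {A : Set ℝ}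
    (hA : MeasurableSet A) :
    |(normalLaw m s).real A - (normalLaw m t).real A| ≤ |s ^ 2 / t ^ 2 - 1| := by
  have h0 : |s - t| / t ≤ |s ^ 2 / t ^ 2 - 1| := by
    have h1 : s ^ 2 / t ^ 2 - 1 = (s - t) / t * (s / t + 1) := by field_simp; ring
    have h2 : 1 ≤ |s / t + 1| := by
      rw [abs_of_pos (by positivity)]
      linarith [div_pos hs ht]
    rw [h1, abs_mul, abs_div, abs_of_pos ht]
    exact le_mul_of_one_le_right (by positivity) h2
  refine le_trans ?_ h0
  rcases le_total t s with h | h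
  · refine (normalLaw_scale_le_of_le ht h m hA).trans ?_
    rw [abs_of_nonneg (sub_nonneg.2 h)]
    exact div_le_div_of_nonneg_left (sub_nonneg.2 h) ht h
  · rw [abs_sub_comm, abs_sub_comm s t, abs_of_nonneg (sub_nonneg.2 h)]
    exact normalLaw_scale_le_of_le hs h m hA

/-- A bound on the total variation distance between two Gaussian laws, which is invariant under
affine changes of variable. -/
lemma abs_normalLaw_sub_le {s t : ℝ} (hs : 0 < s) (ht : 0 < t) (m' m : ℝ) {A : Set ℝ}
    (hA : MeasurableSet A) :
    |(normalLaw m' s).real A - (normalLaw m t).real A|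
      ≤ min 1 (2 * (|m' - m| / t) + min 1 |s ^ 2 / t ^ 2 - 1|) := by
  have h1 := abs_normalLaw_shift_le ht m' m A
  have h2 := abs_normalLaw_scale_le hs ht m' hA
  have hle : ∀ μ ν : Measure ℝ, IsProbabilityMeasure μ → IsProbabilityMeasure ν →
      |μ.real A - ν.real A| ≤ 1 := by
    intro μ ν _ _
    have h3 : μ.real A ≤ 1 := measureReal_le_one
    have h4 : ν.real A ≤ 1 := measureReal_le_one
    have h5 : 0 ≤ μ.real A := measureReal_nonneg
    have h6 : 0 ≤ ν.real A := measureReal_nonneg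
    rw [abs_le]; constructor <;> linarith
  refine le_min (hle _ _ inferInstance inferInstance) ?_
  calc |(normalLaw m' s).real A - (normalLaw m t).real A|
      ≤ |(normalLaw m' s).real A - (normalLaw m' t).real A|
        + |(normalLaw m' t).real A - (normalLaw m t).real A| := abs_sub_le _ _ _
    _ ≤ min 1 |s ^ 2 / t ^ 2 - 1| + 2 * (|m' - m| / t) :=
        add_le_add (le_min (hle _ _ inferInstance inferInstance) h2) h1
    _ = _ := add_comm _ _

/-! ### The risk of a classifier of the terminal value -/

/-- The set of the values `x = X_1` to which `g_θ` assigns the label `1`. -/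
def oneSet (θ : Param) : Set ℝ := {x | classify θ x = 1}

/-- The risk `p₀ P(X_1 ∈ A | Y = 0) + p₁ P(X_1 ∉ A | Y = 1)` of the classifier `1_A(X_1)`. -/
noncomputable def endRisk (θ : Param) (A : Set ℝ) : ℝ :=
  θ.p 0 * (normalLaw (θ.mu 0) θ.alpha).real A + θ.p 1 * (normalLaw (θ.mu 1) θ.alpha).real Aᶜ

lemma paramSet_subset_estimateSet : paramSet ⊆ estimateSet :=
  fun _ h => ⟨h.1, fun i => Set.Ioo_subset_Icc_self (h.2.1 i), h.2.2⟩

lemma half_le_regression_iff {θ : Param} (hθ : θ ∈ estimateSet) (x : ℝ) :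
    1 / 2 ≤ regression θ x ↔
      θ.p 0 * normalPDF (θ.mu 0) θ.alpha x - θ.p 1 * normalPDF (θ.mu 1) θ.alpha x ≤ 0 := by
  obtain ⟨ha, hp, hs⟩ := hθ
  set K := (√(2 * Real.pi) * θ.alpha)⁻¹ * Real.exp (-x ^ 2 / (2 * θ.alpha ^ 2)) with hK
  have hK0 : 0 < K := by positivity
  have hpdf : ∀ i, normalPDF (θ.mu i) θ.alpha x = K * Real.exp (score θ i x) := by
    intro i
    rw [normalPDF_eq ha, hK, mul_assoc, ← Real.exp_add]
    congr 2
    rw [score]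
    field_simp
    ring
  rw [hpdf, hpdf, regression]
  set e0 := Real.exp (score θ 0 x)
  set e1 := Real.exp (score θ 1 x)
  have he0 : 0 < e0 := Real.exp_pos _
  have he1 : 0 < e1 := Real.exp_pos _
  have hden : 0 < θ.p 0 * e0 + θ.p 1 * e1 := by
    rcases (hp 0).1.eq_or_lt with h | h
    · rw [← h] at hs ⊢
      have : θ.p 1 = 1 := by linarith
      rw [this]; linarith
    · have := mul_nonneg (hp 1).1 he1.le
      positivity
  have hfac : θ.p 0 * (K * e0) - θ.p 1 * (K * e1) = K * (θ.p 0 * e0 - θ.p 1 * e1) := by ring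
  rw [le_div_iff₀ hden, hfac, mul_nonpos_iff_pos_imp_nonpos]
  constructor
  · intro h
    refine ⟨fun _ => by linarith, fun h' => by linarith⟩
  · rintro ⟨h, -⟩
    linarith [h hK0]

lemma oneSet_eq {θ : Param} (hθ : θ ∈ estimateSet) : oneSet θ =
    {x | θ.p 0 * normalPDF (θ.mu 0) θ.alpha x - θ.p 1 * normalPDF (θ.mu 1) θ.alpha x ≤ 0} := by
  ext x
  rw [Set.mem_ofPred_eq, ← half_le_regression_iff hθ, oneSet, Set.mem_ofPred_eq, classify]
  split_ifs with h <;> simp only [h, zero_ne_one]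

lemma measurable_classify (θ : Param) : Measurable (classify θ) := by
  refine Measurable.ite (measurableSet_le measurable_const ?_) measurable_const measurable_const
  unfold regression score
  fun_prop

lemma measurableSet_oneSet (θ : Param) : MeasurableSet (oneSet θ) :=
  measurable_classify θ (measurableSet_singleton 1)

/-- The Bayes classifier minimizes the risk: it selects the points where the density
`p₀ f₀ - p₁ f₁` is nonpositive. -/
lemma endRisk_oneSet_le {θ : Param} (hθ : θ ∈ estimateSet) {B : Set ℝ} (hB : MeasurableSet B) :
    endRisk θ (oneSet θ) ≤ endRisk θ B := by
  set h : ℝ → ℝ := fun x =>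
    θ.p 0 * normalPDF (θ.mu 0) θ.alpha x - θ.p 1 * normalPDF (θ.mu 1) θ.alpha x with hh
  have hi : Integrable h :=
    ((integrable_normalPDF _ _).const_mul _).sub ((integrable_normalPDF _ _).const_mul _)
  have hm : StronglyMeasurable h :=
    (((measurable_normalPDF _ _).const_mul _).sub
      ((measurable_normalPDF _ _).const_mul _)).stronglyMeasurable
  have hr : ∀ C : Set ℝ, MeasurableSet C → endRisk θ C = θ.p 1 + ∫ x in C, h x := by
    intro C hC
    rw [endRisk, probReal_compl_eq_one_sub hC, normalLaw_real_eq hθ.1, normalLaw_real_eq hθ.1, hh,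
      integral_sub ((integrable_normalPDF _ _).const_mul _).integrableOn
        ((integrable_normalPDF _ _).const_mul _).integrableOn, integral_const_mul,
      integral_const_mul]
    ring
  rw [hr _ (measurableSet_oneSet θ), hr B hB, oneSet_eq hθ]
  exact add_le_add_right (setIntegral_nonpos_le hB hm hi) _

lemma abs_mul_sub_mul_le {p p' x x' c : ℝ} (hp : 0 ≤ p) (hx0 : 0 ≤ x') (hx1 : x' ≤ 1)
    (hc : |x' - x| ≤ c) : |p' * x' - p * x| ≤ |p' - p| + p * c := by
  have h : p' * x' - p * x = (p' - p) * x' + p * (x' - x) := by ring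
  rw [h]
  refine (abs_add_le _ _).trans ?_
  rw [abs_mul, abs_mul, abs_of_nonneg hx0, abs_of_nonneg hp]
  exact add_le_add (mul_le_of_le_one_right (abs_nonneg _) hx1) (by gcongr)

/-- The distance between the parameters `θ'` and `θ` that controls the excess risk of `g_θ'` in the
model `θ`. -/
noncomputable def paramDist (θ' θ : Param) : ℝ :=
  ∑ i, (|θ'.p i - θ.p i| + θ.p i *
    min 1 (2 * (|θ'.mu i - θ.mu i| / θ.alpha) + min 1 |θ'.alpha ^ 2 / θ.alpha ^ 2 - 1|))

lemma abs_endRisk_sub_le {θ θ' : Param} (hθ : θ ∈ estimateSet) (hθ' : θ' ∈ estimateSet)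
    {B : Set ℝ} (hB : MeasurableSet B) :
    |endRisk θ' B - endRisk θ B| ≤ paramDist θ' θ := by
  have h0 := abs_mul_sub_mul_le (p' := θ'.p 0) (hθ.2.1 0).1 measureReal_nonneg measureReal_le_one
    (abs_normalLaw_sub_le hθ'.1 hθ.1 (θ'.mu 0) (θ.mu 0) hB)
  have h1 := abs_mul_sub_mul_le (p' := θ'.p 1) (hθ.2.1 1).1 measureReal_nonneg measureReal_le_one
    (abs_normalLaw_sub_le hθ'.1 hθ.1 (θ'.mu 1) (θ.mu 1) hB.compl)
  rw [paramDist, Fin.sum_univ_two]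
  refine le_trans ?_ (add_le_add h0 h1)
  rw [endRisk, endRisk, add_sub_add_comm]
  exact abs_add_le _ _

/-- The excess risk of a plug-in classifier. As `g_θ'` is optimal in the model `θ'`, only the
change of the risk functional from `θ` to `θ'` matters. -/
lemma endRisk_sub_le {θ θ' : Param} (hθ : θ ∈ estimateSet) (hθ' : θ' ∈ estimateSet) :
    endRisk θ (oneSet θ') - endRisk θ (oneSet θ) ≤ 2 * paramDist θ' θ := by
  have h1 := abs_endRisk_sub_le hθ hθ' (measurableSet_oneSet θ')
  have h2 := abs_endRisk_sub_le hθ hθ' (measurableSet_oneSet θ)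
  have h3 := endRisk_oneSet_le hθ' (measurableSet_oneSet θ)
  rw [abs_le] at h1 h2
  linarith [h1.1, h2.2]

/-! ### The law of an observation -/

section Model

variable {Ω : Type*} [MeasurableSpace Ω] {P : Measure Ω} {W : ℝ≥0 → Ω → ℝ} {n N : ℕ}
  {θ : Param}

lemma risk_nonneg (g : (ℝ≥0 → ℝ) → Fin 2) : 0 ≤ risk P W θ g := measureReal_nonneg

/-- The discretely observed path and the label, as functions of the outcome. -/
noncomputable def observe (W : ℝ≥0 → Ω → ℝ) (n : ℕ) (θ : Param) (z : Ω × Fin 2) : Obs n × Fin 2 :=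
  (discretize n (path W θ z), z.2)

lemma aemeasurable_observe (hW : IsPreBrownianReal W P) (n : ℕ) (θ : Param) :
    AEMeasurable (observe W n θ) (modelMeasure P θ) := by
  refine AEMeasurable.prodMk (aemeasurable_pi_lambda _ fun k => ?_) measurable_snd.aemeasurable
  have h1 : AEMeasurable (fun z : Ω × Fin 2 => W ((k : ℕ) / (n : ℝ≥0)) z.1)
      (modelMeasure P θ) :=
    (hW.aemeasurable _).comp_quasiMeasurePreserving Measure.quasiMeasurePreserving_fst
  have h2 : Measurable fun z : Ω × Fin 2 => θ.mu z.2 * (((k : ℕ) / (n : ℝ≥0) : ℝ≥0) : ℝ) :=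
    ((measurable_of_countable θ.mu).comp measurable_snd).mul_const _
  exact h2.aemeasurable.add (h1.const_mul θ.alpha)

lemma hasLaw_path_one (hW : IsPreBrownianReal W P) (i : Fin 2) :
    HasLaw (fun ω => path W θ (ω, i) 1) (normalLaw (θ.mu i) θ.alpha) P := by
  have h := gaussianReal_const_add (gaussianReal_const_mul (hW.hasLaw_eval 1) θ.alpha) (θ.mu i)
  have hv : NNReal.mk (θ.alpha ^ 2) (sq_nonneg _) * 1 = (θ.alpha ^ 2).toNNReal := by
    rw [mul_one]
    ext
    exact (Real.coe_toNNReal _ (sq_nonneg θ.alpha)).symm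
  rw [mul_zero, zero_add, hv] at h
  simpa [path, normalLaw] using h

variable [IsProbabilityMeasure P]

lemma labelLaw_eq (θ : Param) : labelLaw θ =
    ENNReal.ofReal (θ.p 0) • Measure.dirac 0 + ENNReal.ofReal (θ.p 1) • Measure.dirac 1 := by
  rw [labelLaw, Fin.sum_univ_two]

instance (θ : Param) : IsFiniteMeasure (labelLaw θ) := by
  refine ⟨?_⟩
  rw [labelLaw_eq]
  simp [ENNReal.add_lt_top]

lemma isProbabilityMeasure_labelLaw (hθ : θ ∈ estimateSet) :
    IsProbabilityMeasure (labelLaw θ) := by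
  refine ⟨?_⟩
  rw [labelLaw_eq]
  simp [← ENNReal.ofReal_add (hθ.2.1 0).1 (hθ.2.1 1).1, hθ.2.2]

lemma integral_labelLaw (hθ : θ ∈ estimateSet) (g : Fin 2 → ℝ) :
    ∫ i, g i ∂(labelLaw θ) = θ.p 0 * g 0 + θ.p 1 * g 1 := by
  have hfin : ∀ i : Fin 2, Integrable g (ENNReal.ofReal (θ.p i) • Measure.dirac i) := fun i =>
    (integrable_dirac (by finiteness)).smul_measure ENNReal.ofReal_ne_top
  rw [labelLaw_eq, integral_add_measure (hfin 0) (hfin 1),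
    integral_smul_measure, integral_smul_measure, integral_dirac, integral_dirac,
    ENNReal.toReal_ofReal (hθ.2.1 0).1, ENNReal.toReal_ofReal (hθ.2.1 1).1, smul_eq_mul,
    smul_eq_mul]

lemma isProbabilityMeasure_modelMeasure (hθ : θ ∈ estimateSet) :
    IsProbabilityMeasure (modelMeasure P θ) := by
  have := isProbabilityMeasure_labelLaw hθ
  unfold modelMeasure
  infer_instance

/-- Disintegration of the joint law along the label. The label takes finitely many values, hence
the set `S` need not be measurable. -/
lemma modelMeasure_real_apply (hθ : θ ∈ estimateSet) (S : Set (Ω × Fin 2)) :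
    (modelMeasure P θ).real S =
      θ.p 0 * P.real {ω | (ω, 0) ∈ S} + θ.p 1 * P.real {ω | (ω, 1) ∈ S} := by
  have h : modelMeasure P θ S = ENNReal.ofReal (θ.p 0) * P {ω | (ω, 0) ∈ S}
      + ENNReal.ofReal (θ.p 1) * P {ω | (ω, 1) ∈ S} := by
    rw [modelMeasure, labelLaw_eq, Measure.prod_add, Measure.prod_smul_right,
      Measure.prod_smul_right, Measure.prod_dirac, Measure.prod_dirac, Measure.add_apply,
      Measure.smul_apply, Measure.smul_apply, (measurableEmbedding_prod_mk_right 0).map_apply,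
      (measurableEmbedding_prod_mk_right 1).map_apply]
    rfl
  rw [Measure.real, h, ENNReal.toReal_add (by finiteness) (by finiteness), ENNReal.toReal_mul,
    ENNReal.toReal_mul, ENNReal.toReal_ofReal (hθ.2.1 0).1, ENNReal.toReal_ofReal (hθ.2.1 1).1]
  rfl

lemma risk_eq (hθ : θ ∈ estimateSet) (g : (ℝ≥0 → ℝ) → Fin 2) :
    risk P W θ g = θ.p 0 * P.real {ω | g (path W θ (ω, 0)) = 1}
      + θ.p 1 * P.real {ω | g (path W θ (ω, 1)) = 0} := by
  have h0 : ∀ i : Fin 2, i ≠ 0 ↔ i = 1 := by decide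
  have h1 : ∀ i : Fin 2, i ≠ 1 ↔ i = 0 := by decide
  rw [risk, modelMeasure_real_apply hθ]
  simp [h0, h1]

lemma risk_le_one (hθ : θ ∈ estimateSet) (g : (ℝ≥0 → ℝ) → Fin 2) : risk P W θ g ≤ 1 := by
  have := isProbabilityMeasure_modelMeasure (P := P) hθ
  exact measureReal_le_one

/-- The risk of a classifier that depends only on the terminal value of the path. -/
lemma risk_eq_endRisk (hW : IsPreBrownianReal W P) (hθ : θ ∈ estimateSet) {c : ℝ → Fin 2}
    (hc : Measurable c) : risk P W θ (fun x => c (x 1)) = endRisk θ {x | c x = 1} := by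
  have h0 := (hasLaw_path_one (θ := θ) hW 0).measureReal_eq (p := fun x => c x = 1)
    (hc (measurableSet_singleton 1))
  have h1 := (hasLaw_path_one (θ := θ) hW 1).measureReal_eq (p := fun x => c x = 0)
    (hc (measurableSet_singleton 0))
  have h2 : {x | c x = 1}ᶜ = {x | c x = 0} := by
    have h3 : ∀ i : Fin 2, i ≠ 1 ↔ i = 0 := by decide
    ext x
    exact h3 _
  rw [risk_eq hθ, h0, h1, endRisk, h2]

lemma risk_bayes (hW : IsPreBrownianReal W P) (hθ : θ ∈ estimateSet) :
    risk P W θ (bayes θ) = endRisk θ (oneSet θ) :=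
  risk_eq_endRisk hW hθ (measurable_classify θ)

lemma isProbabilityMeasure_obsLaw (hW : IsPreBrownianReal W P) (n : ℕ) (hθ : θ ∈ estimateSet) :
    IsProbabilityMeasure (obsLaw P W n θ) := by
  have := isProbabilityMeasure_modelMeasure (P := P) hθ
  exact Measure.isProbabilityMeasure_map (aemeasurable_observe hW n θ)

lemma isProbabilityMeasure_sampleLaw (hW : IsPreBrownianReal W P) (N n : ℕ)
    (hθ : θ ∈ estimateSet) : IsProbabilityMeasure (sampleLaw P W N n θ) := by
  have := isProbabilityMeasure_obsLaw hW n hθ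
  unfold sampleLaw
  infer_instance

lemma excessRisk_le_one (hW : IsPreBrownianReal W P) (hθ : θ ∈ estimateSet) (g : Rule N n) :
    excessRisk P W N n θ g ≤ 1 := by
  have := isProbabilityMeasure_sampleLaw hW N n hθ
  have h := norm_integral_le_of_norm_le_const (μ := sampleLaw P W N n θ) (C := 1)
    (ae_of_all _ fun D => show ‖risk P W θ (fun x => g D (discretize n x))
      - risk P W θ (bayes θ)‖ ≤ 1 from ?_)
  · refine (le_abs_self _).trans ?_
    simpa [excessRisk] using! h
  · have h1 := risk_le_one (P := P) (W := W) hθ (fun x => g D (discretize n x))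
    have h2 := risk_le_one (P := P) (W := W) hθ (bayes θ)
    have h3 := risk_nonneg (P := P) (W := W) (θ := θ) (fun x => g D (discretize n x))
    have h4 := risk_nonneg (P := P) (W := W) (θ := θ) (bayes θ)
    rw [Real.norm_eq_abs, abs_le]
    constructor <;> linarith

/-! ### Empirical means -/

/-- The empirical mean of `φ` over the learning sample. -/
noncomputable def sampleMean (φ : Obs n × Fin 2 → ℝ) (D : Sample N n) : ℝ :=
  (N : ℝ)⁻¹ * ∑ j, φ (D j)

lemma measurable_sampleMean {φ : Obs n × Fin 2 → ℝ} (hφ : Measurable φ) :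
    Measurable (sampleMean φ : Sample N n → ℝ) := by
  unfold sampleMean
  fun_prop

lemma memLp_sampleMean_and_integral_abs_le {μ : Measure (Obs n × Fin 2)}
    [IsProbabilityMeasure μ] (hN : 0 < N) {φ : Obs n × Fin 2 → ℝ} (hφ : MemLp φ 2 μ)
    (h0 : ∫ z, φ z ∂μ = 0) {v : ℝ} (hv : ∫ z, φ z ^ 2 ∂μ ≤ v) :
    Integrable (sampleMean φ) (Measure.pi fun _ : Fin N => μ) ∧
      ∫ D, |sampleMean φ D| ∂(Measure.pi fun _ : Fin N => μ) ≤ √v / √N := by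
  set ν := Measure.pi fun _ : Fin N => μ with hν
  have hN' : (0 : ℝ) < N := by exact_mod_cast hN
  have hj : ∀ j : Fin N, MemLp (fun D : Sample N n => φ (D j)) 2 ν := fun j =>
    hφ.comp_measurePreserving (measurePreserving_eval (fun _ : Fin N => μ) j)
  have hS : MemLp (fun D : Sample N n => ∑ j, φ (D j)) 2 ν := memLp_finsetSum _ fun j _ => hj j
  have hM : MemLp (sampleMean φ) 2 ν := hS.const_mul _
  have hint : ∫ D : Sample N n, ∑ j, φ (D j) ∂ν = 0 := by
    rw [integral_finsetSum _ fun j _ => (hj j).integrable one_le_two]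
    refine Finset.sum_eq_zero fun j _ => ?_
    rw [hν, integral_comp_eval (μ := fun _ : Fin N => μ) hφ.aestronglyMeasurable, h0]
  have hvar : ∫ D : Sample N n, (∑ j, φ (D j)) ^ 2 ∂ν ≤ N * v := by
    have h1 := variance_sum_pi (μ := fun _ : Fin N => μ) (X := fun _ => φ) fun _ => hφ
    have h2 : (∑ j : Fin N, fun D : Sample N n => φ (D j)) = fun D => ∑ j, φ (D j) := by
      ext D; simp
    rw [h2, variance_of_integral_eq_zero hS.aemeasurable hint] at h1
    rw [h1, variance_of_integral_eq_zero hφ.aemeasurable h0]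
    simp only [Finset.sum_const, Finset.card_univ, Fintype.card_fin, nsmul_eq_mul]
    gcongr
  have hsq : ∫ D, sampleMean φ D ^ 2 ∂ν ≤ v / N := by
    have h3 : ∀ D : Sample N n, sampleMean φ D ^ 2 = ((N : ℝ)⁻¹) ^ 2 * (∑ j, φ (D j)) ^ 2 :=
      fun D => mul_pow _ _ _
    simp_rw [h3]
    rw [integral_const_mul]
    calc ((N : ℝ)⁻¹) ^ 2 * ∫ D : Sample N n, (∑ j, φ (D j)) ^ 2 ∂ν
        ≤ ((N : ℝ)⁻¹) ^ 2 * (N * v) := by gcongr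
      _ = v / N := by field_simp
  refine ⟨hM.integrable one_le_two, ?_⟩
  have h4 : (∫ D, |sampleMean φ D| ∂ν) ^ 2 ≤ ∫ D, sampleMean φ D ^ 2 ∂ν := by
    have h5 := variance_nonneg (fun D => |sampleMean φ D|) ν
    have h6 := variance_eq_sub (μ := ν) (X := fun D => |sampleMean φ D|) hM.abs
    simp only [Pi.pow_apply, sq_abs] at h6
    linarith
  rw [← Real.sqrt_div' _ hN'.le]
  exact Real.le_sqrt_of_sq_le (h4.trans hsq)

/-- The law of large numbers in `L¹`, with the rate `N ^ (-1/2)`, for a statistic that is a product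
of a function of the noise and of a function of the label. -/
lemma integral_abs_sampleMean_le (hW : IsPreBrownianReal W P) (hθ : θ ∈ estimateSet) (hN : 0 < N)
    {φ : Obs n × Fin 2 → ℝ} (hφ : Measurable φ) {f : Ω → ℝ} {g : Fin 2 → ℝ}
    (hfg : ∀ z, φ (observe W n θ z) = f z.1 * g z.2) (hf : MemLp f 2 P)
    (h0 : (∫ ω, f ω ∂P) * (θ.p 0 * g 0 + θ.p 1 * g 1) = 0) {v : ℝ}
    (hv : (∫ ω, f ω ^ 2 ∂P) * (θ.p 0 * g 0 ^ 2 + θ.p 1 * g 1 ^ 2) ≤ v) :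
    Integrable (sampleMean φ) (sampleLaw P W N n θ) ∧
      ∫ D, |sampleMean φ D| ∂(sampleLaw P W N n θ) ≤ √v / √N := by
  have := isProbabilityMeasure_obsLaw hW n hθ
  have hT := aemeasurable_observe hW n θ
  have hsq : ∀ z, φ (observe W n θ z) ^ 2 = f z.1 ^ 2 * g z.2 ^ 2 := fun z => by
    rw [hfg, mul_pow]
  have hL2 : MemLp φ 2 (obsLaw P W n θ) := by
    refine (memLp_map_measure_iff hφ.aestronglyMeasurable hT).2 ?_
    refine (memLp_two_iff_integrable_sq
      (hφ.comp_aemeasurable hT).aestronglyMeasurable).2 ?_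
    simp only [Function.comp_apply, hsq]
    exact hf.integrable_sq.mul_prod (Integrable.of_finite (μ := labelLaw θ) (f := fun i => g i ^ 2))
  have hI0 : ∫ z, φ z ∂(obsLaw P W n θ) = 0 := by
    have h1 : ∫ z, φ z ∂(obsLaw P W n θ) = ∫ z, φ (observe W n θ z) ∂(modelMeasure P θ) :=
      integral_map hT hφ.aestronglyMeasurable
    simp_rw [h1, hfg]
    rw [modelMeasure, integral_prod_mul f g, integral_labelLaw hθ, h0]
  have hI2 : ∫ z, φ z ^ 2 ∂(obsLaw P W n θ) ≤ v := by
    have h1 : ∫ z, φ z ^ 2 ∂(obsLaw P W n θ)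
        = ∫ z, φ (observe W n θ z) ^ 2 ∂(modelMeasure P θ) :=
      integral_map hT (hφ.pow_const 2).aestronglyMeasurable
    simp_rw [h1, hsq]
    rw [modelMeasure, integral_prod_mul (fun ω => f ω ^ 2) (fun i => g i ^ 2),
      integral_labelLaw hθ]
    exact hv
  exact memLp_sampleMean_and_integral_abs_le hN hL2 hI0 hI2

end Model

/-! ### The empirical plug-in rule -/

section Estimator

variable {Ω : Type*} [MeasurableSpace Ω] {P : Measure Ω} [IsProbabilityMeasure P]
  {W : ℝ≥0 → Ω → ℝ} {n N : ℕ} {θ : Param}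

/-- The indicator of the label `i`. -/
noncomputable def labelInd (i k : Fin 2) : ℝ := if k = i then 1 else 0

/-- The empirical frequency of the label `i`. -/
noncomputable def freq (i : Fin 2) (D : Sample N n) : ℝ :=
  sampleMean (fun z => labelInd i z.2) D

/-- The estimated drift of the class `i`: the mean of `X_1` over the observations with this label.
It is `0` by the convention `x / 0 = 0` if there are none. -/
noncomputable def drift (i : Fin 2) (D : Sample N n) : ℝ :=
  sampleMean (fun z => z.1 (Fin.last n) * labelInd i z.2) D / freq i D

/-- The estimator of `θ` by the empirical label frequencies, the empirical drifts, and a given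
estimator of the diffusion coefficient. -/
noncomputable def estimator (ahat : Sample N n → ℝ) (D : Sample N n) : Param where
  mu i := drift i D
  alpha := ahat D
  p i := freq i D

lemma measurable_labelInd (i : Fin 2) : Measurable (labelInd i) := measurable_of_countable _

lemma labelInd_nonneg (i k : Fin 2) : 0 ≤ labelInd i k := by
  unfold labelInd; split_ifs <;> norm_num

lemma labelInd_zero_add_one (k : Fin 2) : labelInd 0 k + labelInd 1 k = 1 := by
  fin_cases k <;> simp [labelInd]

lemma measurable_freq (i : Fin 2) : Measurable (freq i : Sample N n → ℝ) :=
  measurable_sampleMean ((measurable_labelInd i).comp measurable_snd)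

lemma measurable_drift (i : Fin 2) : Measurable (drift i : Sample N n → ℝ) := by
  refine (measurable_sampleMean ?_).div (measurable_freq i)
  exact ((measurable_pi_apply _).comp measurable_fst).mul
    ((measurable_labelInd i).comp measurable_snd)

lemma freq_nonneg (i : Fin 2) (D : Sample N n) : 0 ≤ freq i D :=
  mul_nonneg (by positivity) (Finset.sum_nonneg fun _ _ => labelInd_nonneg _ _)

lemma freq_zero_add_one (hN : 0 < N) (D : Sample N n) : freq 0 D + freq 1 D = 1 := by
  have hN' : (N : ℝ) ≠ 0 := by exact_mod_cast hN.ne'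
  rw [freq, freq, sampleMean, sampleMean, ← mul_add, ← Finset.sum_add_distrib]
  simp [labelInd_zero_add_one, hN']

lemma freq_le_one (hN : 0 < N) (i : Fin 2) (D : Sample N n) : freq i D ≤ 1 := by
  have h := freq_zero_add_one hN D
  have h0 := freq_nonneg 0 D
  have h1 := freq_nonneg 1 D
  fin_cases i
  · simp only [Fin.zero_eta]; linarith
  · simp only [Fin.mk_one]; linarith

lemma estimator_mem (hN : 0 < N) {ahat : Sample N n → ℝ} (hpos : ∀ D, 0 < ahat D)
    (D : Sample N n) : estimator ahat D ∈ estimateSet :=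
  ⟨hpos D, fun i => ⟨freq_nonneg i D, freq_le_one hN i D⟩, freq_zero_add_one hN D⟩

lemma isEstimator_estimator {ahat : Sample N n → ℝ} (hm : Measurable ahat) {T : Set Param}
    (hT : ∀ D, estimator ahat D ∈ T) : IsEstimator T (estimator ahat) where
  mem := hT
  measurable_mu := measurable_drift
  measurable_alpha := hm
  measurable_p := measurable_freq

/-- The centred and standardized terminal value on the class `i`, extended by `0`. -/
noncomputable def noise (θ : Param) (i : Fin 2) (z : Obs n × Fin 2) : ℝ :=
  (z.1 (Fin.last n) - θ.mu i) / θ.alpha * labelInd i z.2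

/-- The average of the noise over the class `i` is the error of the estimated drift times the
frequency of the class. -/
lemma sampleMean_noise (hα : 0 < θ.alpha) (i : Fin 2) (D : Sample N n) :
    sampleMean (noise θ i) D = freq i D * ((drift i D - θ.mu i) / θ.alpha) := by
  set M := sampleMean (fun z : Obs n × Fin 2 => z.1 (Fin.last n) * labelInd i z.2) D with hM
  have h1 : sampleMean (noise θ i) D = (M - θ.mu i * freq i D) / θ.alpha := by
    have h2 : ∑ j, noise θ i (D j) = (∑ j, (D j).1 (Fin.last n) * labelInd i (D j).2
        - θ.mu i * ∑ j, labelInd i (D j).2) / θ.alpha := by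
      rw [Finset.mul_sum, ← Finset.sum_sub_distrib, Finset.sum_div]
      refine Finset.sum_congr rfl fun j _ => ?_
      rw [noise]
      ring
    rw [hM, freq, sampleMean, sampleMean, sampleMean, h2]
    ring
  have h2 : M = freq i D * drift i D := by
    rcases eq_or_ne (freq i D) 0 with h | h
    · -- In an empty class the weighted sum of the terminal values vanishes as well.
      rcases Nat.eq_zero_or_pos N with hN | hN
      · subst hN
        simp [hM, h, sampleMean]
      · have hN' : (N : ℝ)⁻¹ ≠ 0 := by positivity
        have h3 : ∑ j, labelInd i (D j).2 = 0 := by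
          simpa [freq, sampleMean, hN.ne'] using h
        have h4 := (Finset.sum_eq_zero_iff_of_nonneg fun j _ => labelInd_nonneg i (D j).2).1 h3
        rw [h, zero_mul, hM, sampleMean, Finset.sum_eq_zero, mul_zero]
        intro j hj
        rw [h4 j hj, mul_zero]
    · rw [drift, mul_div_cancel₀ _ h]
  rw [h1, h2]
  field_simp

/-- A rare class contributes to the risk in proportion to its probability, which makes up for the
small number of observations from which its drift is estimated. -/
lemma mul_min_one_le {p q d e : ℝ} (hq0 : 0 ≤ q) (hq1 : q ≤ 1) (hd : 0 ≤ d) (he : 0 ≤ e) :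
    p * min 1 (2 * d + e) ≤ |q - p| + 2 * (q * d) + e := by
  have h0 : 0 ≤ min 1 (2 * d + e) := le_min zero_le_one (by positivity)
  have h1 : min 1 (2 * d + e) ≤ 1 := min_le_left _ _
  have h2 : min 1 (2 * d + e) ≤ 2 * d + e := min_le_right _ _
  have h3 : p - q ≤ |q - p| := by rw [abs_sub_comm]; exact le_abs_self _
  have h4 : p * min 1 (2 * d + e) = (p - q) * min 1 (2 * d + e) + q * min 1 (2 * d + e) := by ring
  have h5 : (p - q) * min 1 (2 * d + e) ≤ |q - p| := by
    calc (p - q) * min 1 (2 * d + e) ≤ |q - p| * min 1 (2 * d + e) := by gcongr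
      _ ≤ |q - p| := mul_le_of_le_one_right (abs_nonneg _) h1
  have h6 : q * min 1 (2 * d + e) ≤ q * (2 * d + e) := by gcongr
  nlinarith

lemma paramDist_estimator_le (hN : 0 < N) (hθ : θ ∈ estimateSet) (ahat : Sample N n → ℝ)
    (D : Sample N n) :
    paramDist (estimator ahat D) θ ≤
      ∑ i, (2 * |freq i D - θ.p i| + 2 * |sampleMean (noise θ i) D|)
        + 2 * min 1 |ahat D ^ 2 / θ.alpha ^ 2 - 1| := by
  set e := min 1 |ahat D ^ 2 / θ.alpha ^ 2 - 1| with he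
  have he0 : 0 ≤ e := le_min zero_le_one (abs_nonneg _)
  have h : ∀ i, |freq i D - θ.p i| + θ.p i * min 1 (2 * (|drift i D - θ.mu i| / θ.alpha) + e) ≤
      2 * |freq i D - θ.p i| + 2 * |sampleMean (noise θ i) D| + e := by
    intro i
    have h1 := mul_min_one_le (p := θ.p i) (freq_nonneg i D) (freq_le_one hN i D)
      (d := |drift i D - θ.mu i| / θ.alpha) (div_nonneg (abs_nonneg _) hθ.1.le) he0
    have h2 : |sampleMean (noise θ i) D| = freq i D * (|drift i D - θ.mu i| / θ.alpha) := by
      rw [sampleMean_noise hθ.1, abs_mul, abs_of_nonneg (freq_nonneg i D), abs_div,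
        abs_of_pos hθ.1]
    rw [h2]
    linarith
  have h0 := h 0
  have h1 := h 1
  rw [paramDist, Fin.sum_univ_two, Fin.sum_univ_two]
  simp only [estimator]
  linarith

lemma discretize_last (hn : 0 < n) (x : ℝ≥0 → ℝ) : discretize n x (Fin.last n) = x 1 := by
  have : (n : ℝ≥0) ≠ 0 := by exact_mod_cast hn.ne'
  simp [discretize, this]

lemma freq_sub_eq_sampleMean (hN : 0 < N) (i : Fin 2) (D : Sample N n) :
    freq i D - θ.p i = sampleMean (fun z => labelInd i z.2 - θ.p i) D := by
  have hN' : (N : ℝ) ≠ 0 := by exact_mod_cast hN.ne'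
  rw [freq, sampleMean, sampleMean, Finset.sum_sub_distrib, mul_sub]
  simp [hN']

lemma integral_abs_freq_sub_le (hW : IsPreBrownianReal W P) (hθ : θ ∈ estimateSet) (hN : 0 < N)
    (i : Fin 2) :
    Integrable (fun D => freq i D - θ.p i) (sampleLaw P W N n θ) ∧
      ∫ D, |freq i D - θ.p i| ∂(sampleLaw P W N n θ) ≤ 1 / √N := by
  have hp := hθ.2.1
  have hs := hθ.2.2
  have hp0 := hp 0
  have hp1 := hp 1
  simp only [Set.mem_Icc] at hp0 hp1
  simp_rw [freq_sub_eq_sampleMean hN]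
  have hp' : θ.p 1 = 1 - θ.p 0 := by linarith
  have := integral_abs_sampleMean_le (n := n) hW hθ hN (v := 1)
    (φ := fun z => labelInd i z.2 - θ.p i) (f := fun _ => 1) (g := fun k => labelInd i k - θ.p i)
    (((measurable_labelInd i).comp measurable_snd).sub_const _) (fun z => by simp [observe])
    (memLp_const 1) (by fin_cases i <;> simp [labelInd] <;> rw [hp'] <;> ring)
    (by
      fin_cases i <;> simp [labelInd] <;> rw [hp'] <;> nlinarith)
  rwa [Real.sqrt_one] at this

lemma measurable_noise (θ : Param) (i : Fin 2) :
    Measurable (noise θ i : Obs n × Fin 2 → ℝ) :=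
  ((((measurable_pi_apply _).comp measurable_fst).sub_const _).div_const _).mul
    ((measurable_labelInd i).comp measurable_snd)

lemma integral_abs_sampleMean_noise_le (hW : IsPreBrownianReal W P) (hθ : θ ∈ estimateSet)
    (hN : 0 < N) (hn : 0 < n) (i : Fin 2) :
    Integrable (sampleMean (noise θ i)) (sampleLaw P W N n θ) ∧
      ∫ D, |sampleMean (noise θ i) D| ∂(sampleLaw P W N n θ) ≤ 1 / √N := by
  have hL := hW.hasLaw_eval 1
  have hmem : MemLp (W 1) 2 P := (hW.isGaussianProcess.hasGaussianLaw_eval 1).memLp_two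
  have hsq : ∫ ω, W 1 ω ^ 2 ∂P = 1 := by
    rw [← variance_of_integral_eq_zero hL.aemeasurable (hW.integral_eval 1), hL.variance_eq,
      variance_id_gaussianReal]
    simp
  have hp0 := hθ.2.1 0
  have hp1 := hθ.2.1 1
  simp only [Set.mem_Icc] at hp0 hp1
  have := integral_abs_sampleMean_le (n := n) hW hθ hN (v := 1) (f := W 1) (g := labelInd i)
    (measurable_noise θ i)
    (fun z => by
      have hα := hθ.1.ne'
      have h1 : noise θ i (observe W n θ z)
          = (path W θ z 1 - θ.mu i) / θ.alpha * labelInd i z.2 := by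
        simp only [noise, observe, discretize_last hn]
      rw [h1]
      by_cases h : z.2 = i
      · rw [path, h]
        field_simp
        simp
      · simp [labelInd, h])
    hmem (by rw [hW.integral_eval, zero_mul])
    (by
      rw [hsq]
      fin_cases i <;> simp [labelInd] <;> linarith)
  rwa [Real.sqrt_one] at this

/-- The excess risk of the empirical plug-in rule, given a bound on the error of the estimator of
the diffusion coefficient. -/
lemma excessRisk_estimator_le (hW : IsPreBrownianReal W P) (hθ : θ ∈ estimateSet)
    (hN : 0 < N) (hn : 0 < n) {ahat : Sample N n → ℝ} (hpos : ∀ D, 0 < ahat D)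
    {e : Sample N n → ℝ} (hle : ∀ D, min 1 |ahat D ^ 2 / θ.alpha ^ 2 - 1| ≤ e D) {K : ℝ}
    (hei : Integrable e (sampleLaw P W N n θ))
    (heK : ∫ D, e D ∂(sampleLaw P W N n θ) ≤ K / √N) :
    excessRisk P W N n θ (fun D x => classify (estimator ahat D) (x (Fin.last n)))
      ≤ (16 + 4 * K) / √N := by
  have hA := fun i => integral_abs_freq_sub_le (n := n) hW hθ hN i
  have hB := fun i => integral_abs_sampleMean_noise_le (n := n) hW hθ hN hn i
  have hr : ∀ D : Sample N n, risk P W θ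
      (fun x => classify (estimator ahat D) (discretize n x (Fin.last n)))
        - risk P W θ (bayes θ) = endRisk θ (oneSet (estimator ahat D)) - endRisk θ (oneSet θ) := by
    intro D
    simp_rw [discretize_last hn]
    rw [risk_eq_endRisk hW hθ (measurable_classify _), risk_bayes hW hθ]
    rfl
  set G : Sample N n → ℝ := fun D =>
    4 * (|freq 0 D - θ.p 0| + |freq 1 D - θ.p 1|
      + |sampleMean (noise θ 0) D| + |sampleMean (noise θ 1) D|) + 4 * e D with hG
  have hi0 : Integrable (fun D => |freq 0 D - θ.p 0| + |freq 1 D - θ.p 1|)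
    (sampleLaw P W N n θ) := (hA 0).1.abs.add (hA 1).1.abs
  have hi1 : Integrable (fun D => |freq 0 D - θ.p 0| + |freq 1 D - θ.p 1|
    + |sampleMean (noise θ 0) D|) (sampleLaw P W N n θ) := hi0.add (hB 0).1.abs
  have hi2 : Integrable (fun D => |freq 0 D - θ.p 0| + |freq 1 D - θ.p 1|
    + |sampleMean (noise θ 0) D| + |sampleMean (noise θ 1) D|) (sampleLaw P W N n θ) :=
    hi1.add (hB 1).1.abs
  rw [excessRisk]
  simp_rw [hr]
  calc ∫ D, (endRisk θ (oneSet (estimator ahat D)) - endRisk θ (oneSet θ))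
        ∂(sampleLaw P W N n θ) ≤ ∫ D, G D ∂(sampleLaw P W N n θ) := by
        refine integral_mono_of_nonneg (ae_of_all _ fun D => ?_)
          ((hi2.const_mul 4).add (hei.const_mul 4)) (ae_of_all _ fun D => ?_)
        · exact sub_nonneg.2 (endRisk_oneSet_le hθ (measurableSet_oneSet _))
        · have h1 := endRisk_sub_le hθ (estimator_mem hN hpos D)
          have h2 := paramDist_estimator_le hN hθ ahat D
          rw [Fin.sum_univ_two] at h2
          have h3 := hle D
          simp only [hG]
          linarith
    _ = 4 * (∫ D, |freq 0 D - θ.p 0| ∂(sampleLaw P W N n θ)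
          + ∫ D, |freq 1 D - θ.p 1| ∂(sampleLaw P W N n θ)
          + ∫ D, |sampleMean (noise θ 0) D| ∂(sampleLaw P W N n θ)
          + ∫ D, |sampleMean (noise θ 1) D| ∂(sampleLaw P W N n θ))
          + 4 * ∫ D, e D ∂(sampleLaw P W N n θ) := by
        simp only [hG]
        rw [integral_add (hi2.const_mul 4) (hei.const_mul 4), integral_const_mul,
          integral_const_mul, integral_add hi1 (hB 1).1.abs, integral_add hi0 (hB 0).1.abs,
          integral_add (hA 0).1.abs (hA 1).1.abs]
    _ ≤ 4 * (1 / √N + 1 / √N + 1 / √N + 1 / √N) + 4 * (K / √N) := by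
        gcongr
        exacts [(hA 0).2, (hA 1).2, (hB 0).2, (hB 1).2]
    _ = _ := by ring

/-! ### Estimation of the diffusion coefficient -/

/-- The second difference of the path at its first three observation times, standardized by the
standard deviation that it has for a standard Brownian motion. It does not see the drift. -/
noncomputable def secondDiff (hn : 2 ≤ n) (x : Obs n) : ℝ :=
  (√(2 * (1 / n)))⁻¹ * (x ⟨2, by omega⟩ - 2 * x ⟨1, by omega⟩ + x ⟨0, by omega⟩)

lemma hasLaw_secondDiff {Ω : Type*} [MeasurableSpace Ω] {P : Measure Ω} {W : ℝ≥0 → Ω → ℝ}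
    (hW : IsPreBrownianReal W P) (hn : 2 ≤ n) :
    HasLaw (fun ω => secondDiff hn (discretize n fun t => W t ω)) (gaussianReal 0 1) P := by
  have hn0 : (0 : ℝ) < n := by exact_mod_cast (by omega : 0 < n)
  set t : ℝ≥0 := 1 / n with ht
  have htr : (t : ℝ) = 1 / n := by simp [ht]
  have h2t : (2 : ℝ≥0) / n = 2 * t := by rw [ht]; ring
  have hX := hW.hasLaw_eval t
  have hY := hW.hasLaw_sub (2 * t) t
  have hdist : nndist (2 * t).1 t.1 = t := by
    ext
    rw [coe_nndist, Real.dist_eq]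
    have : (2 * t).1 - t.1 = (t : ℝ) := by
      change ((2 * t : ℝ≥0) : ℝ) - (t : ℝ) = t
      push_cast; ring
    rw [this]
    exact abs_of_nonneg t.2
  rw [hdist] at hY
  have hind : IndepFun (-W t) (W (2 * t) - W t) P :=
    (hW.hasIndepIncrements.indepFun_eval_sub zero_le (by
      rw [two_mul]; exact le_add_of_nonneg_left zero_le) hW.eval_zero_ae_eq_zero).neg_left
  have hsum : HasLaw (-W t + (W (2 * t) - W t)) (gaussianReal (-0 + 0) (t + t)) P := by
    rw [← gaussianReal_conv_gaussianReal]
    exact hind.hasLaw_add (gaussianReal_neg hX) hY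
  have hZ := gaussianReal_const_mul hsum (√(2 * (1 / n)))⁻¹
  have hv : NNReal.mk (((√(2 * (1 / n)))⁻¹ : ℝ) ^ 2) (sq_nonneg _) * (t + t) = 1 := by
    ext
    push_cast
    rw [htr, inv_pow, Real.sq_sqrt (by positivity)]
    field_simp
    norm_num
  rw [hv, neg_zero, add_zero, mul_zero] at hZ
  refine hZ.congr ?_
  filter_upwards [hW.eval_zero_ae_eq_zero] with ω hω
  simp only [secondDiff, discretize, Pi.add_apply, Pi.neg_apply, Pi.sub_apply, Nat.cast_ofNat,
    Nat.cast_one, Nat.cast_zero, zero_div, hω, h2t, ← ht]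
  ring

lemma secondDiff_path {Ω : Type*} {W : ℝ≥0 → Ω → ℝ} (hn : 2 ≤ n) (θ : Param)
    (z : Ω × Fin 2) :
    secondDiff hn (discretize n (path W θ z))
      = θ.alpha * secondDiff hn (discretize n fun t => W t z.1) := by
  simp only [secondDiff, discretize, path]
  push_cast
  ring

/-- The empirical mean of the squared second differences, an unbiased estimator of `α ^ 2`. -/
noncomputable def quadVar (hn : 2 ≤ n) (D : Sample N n) : ℝ :=
  sampleMean (fun z => secondDiff hn z.1 ^ 2) D

/-- The estimator of `α`. The value `1` stands in where the estimated variance vanishes. -/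
noncomputable def volatility (hn : 2 ≤ n) (D : Sample N n) : ℝ :=
  if 0 < quadVar hn D then √(quadVar hn D) else 1

lemma measurable_secondDiff (hn : 2 ≤ n) : Measurable (secondDiff hn) := by
  unfold secondDiff
  fun_prop

lemma measurable_quadVar (hn : 2 ≤ n) : Measurable (quadVar hn : Sample N n → ℝ) :=
  measurable_sampleMean (((measurable_secondDiff hn).comp measurable_fst).pow_const 2)

lemma measurable_volatility (hn : 2 ≤ n) : Measurable (volatility hn : Sample N n → ℝ) :=
  Measurable.ite (measurableSet_lt measurable_const (measurable_quadVar hn))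
    (measurable_quadVar hn).sqrt measurable_const

lemma volatility_pos (hn : 2 ≤ n) (D : Sample N n) : 0 < volatility hn D := by
  unfold volatility
  split_ifs with h
  · exact Real.sqrt_pos.2 h
  · exact one_pos

lemma quadVar_nonneg (hn : 2 ≤ n) (D : Sample N n) : 0 ≤ quadVar hn D :=
  mul_nonneg (by positivity) (Finset.sum_nonneg fun _ _ => sq_nonneg _)

lemma min_one_volatility_le (hn : 2 ≤ n) (α : ℝ) (D : Sample N n) :
    min 1 |volatility hn D ^ 2 / α ^ 2 - 1| ≤ |quadVar hn D / α ^ 2 - 1| := by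
  unfold volatility
  split_ifs with h
  · rw [Real.sq_sqrt h.le]
    exact min_le_right _ _
  · -- The relative error of the value `0` is `1`, so the default value does no harm.
    have h0 : quadVar hn D = 0 := le_antisymm (not_lt.1 h) (quadVar_nonneg hn D)
    simp [h0]

/-- The second moment of `Z ^ 2 - 1` for a standard normal variable `Z`. -/
noncomputable def chiVar : ℝ := ∫ x, (x ^ 2 - 1) ^ 2 ∂(gaussianReal 0 1)

lemma memLp_sq_sub_one : MemLp (fun x : ℝ => x ^ 2 - 1) 2 (gaussianReal 0 1) := by
  have h4 : MemLp (fun x : ℝ => x) 4 (gaussianReal 0 1) := memLp_id_gaussianReal 4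
  have : MemLp (fun x : ℝ => x ^ 2) 2 (gaussianReal 0 1) := by
    have h := MemLp.mul (p := 4) (q := 4) (r := 2) (hpqr := ⟨by
      rw [← two_mul, show (4 : ENNReal) = 2 * 2 by norm_num,
        ENNReal.mul_inv (by norm_num) (by norm_num), ← mul_assoc,
        ENNReal.mul_inv_cancel (by norm_num) (by norm_num), one_mul]⟩) h4 h4
    simpa [sq] using! h
  exact this.sub (memLp_const 1)

lemma integral_abs_quadVar_le (hW : IsPreBrownianReal W P) (hθ : θ ∈ estimateSet) (hN : 0 < N)
    (hn : 2 ≤ n) :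
    Integrable (fun D => |quadVar hn D / θ.alpha ^ 2 - 1|) (sampleLaw P W N n θ) ∧
      ∫ D, |quadVar hn D / θ.alpha ^ 2 - 1| ∂(sampleLaw P W N n θ) ≤ √chiVar / √N := by
  have hN' : (N : ℝ) ≠ 0 := by exact_mod_cast hN.ne'
  have hα := hθ.1.ne'
  set φ : Obs n × Fin 2 → ℝ := fun z => secondDiff hn z.1 ^ 2 / θ.alpha ^ 2 - 1 with hφ
  have hmean : ∀ D : Sample N n, quadVar hn D / θ.alpha ^ 2 - 1 = sampleMean φ D := by
    intro D
    rw [hφ, sampleMean, quadVar, sampleMean, Finset.sum_sub_distrib, ← Finset.sum_div]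
    simp
    field_simp
  have hφm : Measurable φ :=
    ((((measurable_secondDiff hn).comp measurable_fst).pow_const 2).div_const _).sub_const _
  have hL := hasLaw_secondDiff hW hn
  have hmp := memLp_sq_sub_one
  rw [← hL.map_eq] at hmp
  have hf := (memLp_map_measure_iff hmp.aestronglyMeasurable hL.aemeasurable).1 hmp
  have hI0 := hL.integral_comp (f := fun x => x ^ 2 - 1) (by fun_prop)
  have hI2 := hL.integral_comp (f := fun x => (x ^ 2 - 1) ^ 2) (by fun_prop)
  have hsq : ∫ x, (x ^ 2 - 1) ∂(gaussianReal 0 1) = 0 := by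
    have h1 := variance_fun_id_gaussianReal (μ := 0) (v := 1)
    rw [variance_of_integral_eq_zero (by fun_prop) integral_id_gaussianReal] at h1
    have h2 : Integrable (fun x : ℝ => x ^ 2) (gaussianReal 0 1) :=
      (memLp_id_gaussianReal (μ := 0) (v := 1) 2).integrable_sq
    rw [integral_sub h2 (integrable_const _), h1]
    simp
  have hone : θ.p 0 * 1 ^ 2 + θ.p 1 * 1 ^ 2 = 1 := by rw [one_pow, mul_one, mul_one, hθ.2.2]
  simp_rw [hmean]
  have := integral_abs_sampleMean_le (n := n) hW hθ hN (v := chiVar) (g := fun _ => 1) hφm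
    (fun z => by
      simp only [hφ, observe, secondDiff_path]
      rw [mul_pow, mul_div_cancel_left₀ _ (pow_ne_zero 2 hα)]
      simp only [mul_one]
      rfl) hf (by rw [hI0, hsq, zero_mul])
    (by
      rw [hone, mul_one]
      exact hI2.le)
  exact ⟨this.1.abs, this.2⟩

end Estimator

/-! ### The lower bound -/

/-- A product of measures with densities has the product density. -/
lemma pi_withDensity {ι : Type*} [Fintype ι] {X : ι → Type*} [∀ i, MeasurableSpace (X i)]
    (μ : ∀ i, Measure (X i)) [∀ i, IsProbabilityMeasure (μ i)] (f : ∀ i, X i → ENNReal)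
    (hf : ∀ i, Measurable (f i)) [∀ i, SigmaFinite ((μ i).withDensity (f i))] :
    Measure.pi (fun i => (μ i).withDensity (f i))
      = (Measure.pi μ).withDensity fun x => ∏ i, f i (x i) := by
  refine Measure.pi_eq fun s hs => ?_
  have hm : ∀ i, Measurable ((s i).indicator (f i)) := fun i => (hf i).indicator (hs i)
  have hind : (Set.univ.pi s).indicator (fun x => ∏ i, f i (x i))
      = fun x => ∏ i, (s i).indicator (f i) (x i) := by
    ext x
    by_cases hx : x ∈ Set.univ.pi s
    · rw [Set.indicator_of_mem hx]
      exact Finset.prod_congr rfl fun i _ => (Set.indicator_of_mem (hx i (Set.mem_univ i)) _).symm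
    · rw [Set.indicator_of_notMem hx]
      simp only [Set.mem_univ_pi, not_forall] at hx
      obtain ⟨i, hi⟩ := hx
      exact (Finset.prod_eq_zero (Finset.mem_univ i) (Set.indicator_of_notMem hi _)).symm
  rw [withDensity_apply _ (MeasurableSet.univ_pi hs),
    ← lintegral_indicator (MeasurableSet.univ_pi hs), hind]
  refine (lintegral_prod_eq_prod_lintegral_of_indepFun Finset.univ
    (fun i (x : ∀ i, X i) => (s i).indicator (f i) (x i))
    (iIndepFun_pi fun i => (hm i).aemeasurable)
    fun i => (hm i).comp (measurable_pi_apply i)).trans ?_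
  refine Finset.prod_congr rfl fun i _ => ?_
  rw [withDensity_apply _ (hs i), ← lintegral_indicator (hs i)]
  exact (measurePreserving_eval μ i).lintegral_comp (hm i)

/-- The parameter with no drift and with `P(Y = 1) = q`. The path is then independent of the label,
and the best classifier predicts the more likely label. -/
noncomputable def coin (α q : ℝ) : Param where
  mu _ := 0
  alpha := α
  p := ![1 - q, q]

lemma coin_mem {α q : ℝ} (hα : 0 < α) (hq0 : 0 < q) (hq1 : q < 1) : coin α q ∈ paramSet := by
  refine ⟨hα, fun i => ?_, by simp [coin]⟩
  fin_cases i
  · exact ⟨by simpa [coin] using hq1, by simpa [coin] using hq0⟩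
  · exact ⟨by simpa [coin] using hq0, by simpa [coin] using hq1⟩

/-- The likelihood ratio, for one label, of `coin α q` with respect to `coin α (1 / 2)`. -/
noncomputable def coinRatio (q : ℝ) (i : Fin 2) : ℝ := 2 * ![1 - q, q] i

lemma coinRatio_nonneg {q : ℝ} (hq0 : 0 < q) (hq1 : q < 1) (i : Fin 2) : 0 ≤ coinRatio q i := by
  fin_cases i <;> simp [coinRatio] <;> linarith

lemma labelLaw_singleton (θ : Param) (i : Fin 2) :
    labelLaw θ {i} = ENNReal.ofReal (θ.p i) := by
  rw [labelLaw_eq]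
  fin_cases i <;> simp

lemma labelLaw_coin (α : ℝ) (q : ℝ) : labelLaw (coin α q) =
    (labelLaw (coin α (1 / 2))).withDensity fun i => ENNReal.ofReal (coinRatio q i) := by
  refine Measure.ext_of_singleton fun i => ?_
  rw [withDensity_apply _ (measurableSet_singleton i), lintegral_singleton, labelLaw_singleton,
    labelLaw_singleton, ← ENNReal.ofReal_mul' (by fin_cases i <;> norm_num [coin])]
  congr 1
  fin_cases i <;> simp [coin, coinRatio] <;> ring

section Model

variable {Ω : Type*} [MeasurableSpace Ω] {P : Measure Ω} [IsProbabilityMeasure P]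
  {W : ℝ≥0 → Ω → ℝ} {n N : ℕ} {α q : ℝ}

/-- The law of the discretely observed path in the absence of a drift. -/
noncomputable def noiseLaw (P : Measure Ω) (W : ℝ≥0 → Ω → ℝ) (n : ℕ) (α : ℝ) : Measure (Obs n) :=
  P.map fun ω => discretize n fun t => α * W t ω

lemma aemeasurable_noise_path {Ω : Type*} [MeasurableSpace Ω] {P : Measure Ω} {W : ℝ≥0 → Ω → ℝ}
    (hW : IsPreBrownianReal W P) (n : ℕ) (α : ℝ) :
    AEMeasurable (fun ω => discretize n fun t => α * W t ω) P :=
  aemeasurable_pi_lambda _ fun _ => (hW.aemeasurable _).const_mul α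

lemma path_coin {Ω : Type*} (W : ℝ≥0 → Ω → ℝ) (z : Ω × Fin 2) :
    path W (coin α q) z = fun t => α * W t z.1 := by
  ext t
  simp [path, coin]

lemma obsLaw_coin_eq_prod (hW : IsPreBrownianReal W P) :
    obsLaw P W n (coin α q) = (noiseLaw P W n α).prod (labelLaw (coin α q)) := by
  have hf := aemeasurable_noise_path hW n α
  have : IsProbabilityMeasure (noiseLaw P W n α) := Measure.isProbabilityMeasure_map hf
  refine (Measure.prod_eq fun s t hs ht => ?_).symm
  change (modelMeasure P (coin α q)).map (observe W n (coin α q)) (s ×ˢ t) = _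
  rw [Measure.map_apply_of_aemeasurable (aemeasurable_observe hW n (coin α q)) (hs.prod ht),
    noiseLaw, Measure.map_apply_of_aemeasurable hf hs, modelMeasure,
    ← Measure.prod_prod]
  congr 1
  ext z
  simp [observe, path_coin]

lemma obsLaw_coin (hW : IsPreBrownianReal W P) : obsLaw P W n (coin α q) =
    (obsLaw P W n (coin α (1 / 2))).withDensity
      fun z => ENNReal.ofReal (coinRatio q z.2) := by
  rw [obsLaw_coin_eq_prod hW, obsLaw_coin_eq_prod hW, labelLaw_coin α q,
    prod_withDensity_right (measurable_of_countable _)]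

/-- The likelihood ratio of the learning sample for `coin α q` with respect to
`coin α (1 / 2)`. -/
noncomputable def lik (q : ℝ) (D : Sample N n) : ℝ := ∏ j, coinRatio q (D j).2

lemma measurable_coinRatio_snd (q : ℝ) : Measurable fun z : Obs n × Fin 2 => coinRatio q z.2 :=
  (measurable_of_countable (coinRatio q)).comp measurable_snd

lemma measurable_lik (q : ℝ) : Measurable (lik q : Sample N n → ℝ) :=
  Finset.measurable_fun_prod _ fun j _ =>
    (measurable_coinRatio_snd q).comp (measurable_pi_apply j)

lemma lik_nonneg (hq0 : 0 < q) (hq1 : q < 1) (D : Sample N n) : 0 ≤ lik q D :=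
  Finset.prod_nonneg fun _ _ => coinRatio_nonneg hq0 hq1 _

lemma sampleLaw_coin (hW : IsPreBrownianReal W P) (hα : 0 < α) (hq0 : 0 < q) (hq1 : q < 1) :
    sampleLaw P W N n (coin α q) =
      (sampleLaw P W N n (coin α (1 / 2))).withDensity fun D => ENNReal.ofReal (lik q D) := by
  have h0 := isProbabilityMeasure_obsLaw hW n
    (paramSet_subset_estimateSet (coin_mem hα (q := 1 / 2) (by norm_num) (by norm_num)))
  have h1 := isProbabilityMeasure_obsLaw hW n
    (paramSet_subset_estimateSet (coin_mem hα hq0 hq1))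
  rw [obsLaw_coin hW] at h1
  rw [sampleLaw, obsLaw_coin hW, pi_withDensity (fun _ : Fin N => obsLaw P W n (coin α (1 / 2)))
    (fun _ z => ENNReal.ofReal (coinRatio q z.2))
    (fun _ => (measurable_coinRatio_snd q).ennreal_ofReal)]
  simp only [lik, ENNReal.ofReal_prod_of_nonneg fun _ _ => coinRatio_nonneg hq0 hq1 _]
  rfl

lemma integral_sampleLaw_coin (hW : IsPreBrownianReal W P) (hα : 0 < α) (hq0 : 0 < q)
    (hq1 : q < 1) (h : Sample N n → ℝ) :
    ∫ D, h D ∂(sampleLaw P W N n (coin α q)) =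
      ∫ D, lik q D * h D ∂(sampleLaw P W N n (coin α (1 / 2))) := by
  rw [sampleLaw_coin hW hα hq0 hq1, integral_withDensity_eq_integral_toReal_smul
    (measurable_lik q).ennreal_ofReal (ae_of_all _ fun _ => ENNReal.ofReal_lt_top)]
  simp [ENNReal.toReal_ofReal (lik_nonneg hq0 hq1 _)]

lemma integrable_lik (hW : IsPreBrownianReal W P) (hα : 0 < α) (hq0 : 0 < q) (hq1 : q < 1) :
    Integrable (lik q) (sampleLaw P W N n (coin α (1 / 2))) := by
  have h1 := isProbabilityMeasure_sampleLaw hW N n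
    (paramSet_subset_estimateSet (coin_mem hα hq0 hq1))
  have h2 : Integrable (fun _ => (1 : ℝ)) (sampleLaw P W N n (coin α q)) := integrable_const _
  rw [sampleLaw_coin hW hα hq0 hq1, integrable_withDensity_iff_integrable_smul'
    (measurable_lik q).ennreal_ofReal (ae_of_all _ fun _ => ENNReal.ofReal_lt_top)] at h2
  simpa [ENNReal.toReal_ofReal (lik_nonneg hq0 hq1 _)] using! h2

lemma integral_lik (hW : IsPreBrownianReal W P) (hα : 0 < α) (hq0 : 0 < q) (hq1 : q < 1) :
    ∫ D, lik q D ∂(sampleLaw P W N n (coin α (1 / 2))) = 1 := by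
  have h1 := isProbabilityMeasure_sampleLaw hW N n
    (paramSet_subset_estimateSet (coin_mem hα hq0 hq1))
  have h2 := integral_sampleLaw_coin (N := N) (n := n) hW hα hq0 hq1 fun _ => 1
  simpa using h2.symm

lemma lik_mul_lik (ε : ℝ) (D : Sample N n) :
    lik (1 / 2 + ε) D * lik (1 / 2 - ε) D = (1 - 4 * ε ^ 2) ^ N := by
  have h : ∀ i, coinRatio (1 / 2 + ε) i * coinRatio (1 / 2 - ε) i = 1 - 4 * ε ^ 2 := by
    intro i
    fin_cases i <;> simp [coinRatio] <;> ring
  rw [lik, lik, ← Finset.prod_mul_distrib, Finset.prod_congr rfl fun j _ => h (D j).2]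
  simp

/-- The smaller of two numbers `x`, `y` is `x y / max x y`, and this is bounded from below by the
tangent of `t ↦ 1 / t` at `t = 2`, evaluated at `t = x + y`. -/
lemma mul_tangent_le {x y t : ℝ} (hx : 0 ≤ x) (hy : 0 ≤ y) (ht0 : 0 ≤ t) (ht1 : t ≤ 1) :
    x * y * (1 - (x + y) / 4) ≤ x * (1 - t) + y * t := by
  have key : ∀ m M : ℝ, 0 ≤ m → m ≤ M → m * M * (1 - (m + M) / 4) ≤ m := by
    intro m M hm hmM
    have h1 : M * (1 - (m + M) / 4) ≤ 1 := by
      nlinarith [sq_nonneg (M - 2), mul_nonneg hm (hm.trans hmM)]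
    calc m * M * (1 - (m + M) / 4) = m * (M * (1 - (m + M) / 4)) := by ring
      _ ≤ m * 1 := by gcongr
      _ = m := mul_one m
  rcases le_total x y with h | h
  · nlinarith [key x y hx h, mul_nonneg ht0 (sub_nonneg.2 h)]
  · nlinarith [key y x hy h, mul_nonneg (sub_nonneg.2 ht1) (sub_nonneg.2 h)]

/-- The probability that the rule `g`, trained on the sample `D`, predicts the label `1` for a new
path without drift. -/
noncomputable def predictOne (P : Measure Ω) (W : ℝ≥0 → Ω → ℝ) (α : ℝ) (g : Rule N n)
    (D : Sample N n) : ℝ :=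
  (noiseLaw P W n α).real {x | g D x = 1}

lemma measurable_predictOne {g : Rule N n} (hg : g ∈ allRules N n) :
    Measurable (predictOne P W α g) :=
  have h : MeasurableSet {z : Sample N n × Obs n | g z.1 z.2 = 1} :=
    hg (measurableSet_singleton 1)
  have : SFinite (noiseLaw P W n α) := by unfold noiseLaw; infer_instance
  (measurable_measure_prodMk_left h).ennreal_toReal

lemma risk_coin (hW : IsPreBrownianReal W P) (hα : 0 < α) (hq0 : 0 < q) (hq1 : q < 1)
    {g : Rule N n} (hg : g ∈ allRules N n) (D : Sample N n) :
    risk P W (coin α q) (fun x => g D (discretize n x)) =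
      (1 - q) * predictOne P W α g D + q * (1 - predictOne P W α g D) := by
  have hf := aemeasurable_noise_path hW n α
  have : IsProbabilityMeasure (noiseLaw P W n α) := Measure.isProbabilityMeasure_map hf
  have hgD : Measurable (g D) := hg.comp measurable_prodMk_left
  have h1 : P.real {ω | g D (discretize n fun t => α * W t ω) = 1} = predictOne P W α g D :=
    (map_measureReal_apply_of_aemeasurable hf (hgD (measurableSet_singleton 1))).symm
  have h0 : P.real {ω | g D (discretize n fun t => α * W t ω) = 0}
      = 1 - predictOne P W α g D := by
    have h5 : (noiseLaw P W n α).real {x | g D x = 1}ᶜ = 1 - predictOne P W α g D :=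
      probReal_compl_eq_one_sub (hgD (measurableSet_singleton 1))
    rw [← h5]
    have h2 : {x | g D x = 1}ᶜ = {x | g D x = 0} := by
      have h3 : ∀ i : Fin 2, i ≠ 1 ↔ i = 0 := by decide
      ext x
      exact h3 _
    have h4 := map_measureReal_apply_of_aemeasurable hf (hgD (measurableSet_singleton 0))
    exact h4.symm.trans (congrArg (noiseLaw P W n α).real h2.symm)
  rw [risk_eq (paramSet_subset_estimateSet (coin_mem hα hq0 hq1))]
  simp only [path_coin, h1, h0]
  simp [coin]

lemma risk_bayes_coin (hα : 0 < α) (hq0 : 0 < q) (hq1 : q < 1) :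
    risk P W (coin α q) (bayes (coin α q)) = if 1 / 2 ≤ q then 1 - q else q := by
  have h : ∀ x, bayes (coin α q) x = if 1 / 2 ≤ q then 1 else 0 := by
    intro x
    simp [bayes, classify, regression, score, coin]
  rw [risk_eq (paramSet_subset_estimateSet (coin_mem hα hq0 hq1))]
  simp only [h]
  split_ifs <;> simp [coin]

/-- The two-point bound: no rule has a small excess risk for both of the parameters
`coin α (1 / 2 ± ε)`. The excess risk is `2 ε` times the probability of predicting the less likely
label. -/
lemma le_excessRisk_add_excessRisk (hW : IsPreBrownianReal W P) (hα : 0 < α) {ε : ℝ}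
    (hε0 : 0 < ε) (hε1 : ε < 1 / 2) {g : Rule N n} (hg : g ∈ allRules N n) :
    ε * (1 - 4 * ε ^ 2) ^ N ≤ excessRisk P W N n (coin α (1 / 2 + ε)) g
      + excessRisk P W N n (coin α (1 / 2 - ε)) g := by
  have ha0 : 0 < 1 / 2 + ε := by linarith
  have ha1 : 1 / 2 + ε < 1 := by linarith
  have hb0 : 0 < 1 / 2 - ε := by linarith
  have hb1 : 1 / 2 - ε < 1 := by linarith
  have hprob : IsProbabilityMeasure (noiseLaw P W n α) :=
    Measure.isProbabilityMeasure_map (aemeasurable_noise_path hW n α)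
  set u := predictOne P W α g with hu
  have hu0 : ∀ D, 0 ≤ u D := fun D => measureReal_nonneg
  have hu1 : ∀ D, u D ≤ 1 := fun D => measureReal_le_one
  have hum : Measurable u := measurable_predictOne hg
  set ν := sampleLaw P W N n (coin α (1 / 2)) with hν
  have := isProbabilityMeasure_sampleLaw hW N n
    (paramSet_subset_estimateSet (coin_mem hα (q := 1 / 2) (by norm_num) (by norm_num)))
  have hLa := integrable_lik (N := N) (n := n) hW hα ha0 ha1
  have hLb := integrable_lik (N := N) (n := n) hW hα hb0 hb1
  have h1 : excessRisk P W N n (coin α (1 / 2 + ε)) g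
      = ∫ D, 2 * ε * (lik (1 / 2 + ε) D * (1 - u D)) ∂ν := by
    rw [excessRisk, integral_sampleLaw_coin hW hα ha0 ha1]
    refine integral_congr_ae (ae_of_all _ fun D => ?_)
    simp only [risk_coin hW hα ha0 ha1 hg, risk_bayes_coin hα ha0 ha1]
    rw [if_pos (by linarith)]
    ring
  have h2 : excessRisk P W N n (coin α (1 / 2 - ε)) g
      = ∫ D, 2 * ε * (lik (1 / 2 - ε) D * u D) ∂ν := by
    rw [excessRisk, integral_sampleLaw_coin hW hα hb0 hb1]
    refine integral_congr_ae (ae_of_all _ fun D => ?_)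
    simp only [risk_coin hW hα hb0 hb1 hg, risk_bayes_coin hα hb0 hb1]
    rw [if_neg (by linarith)]
    ring
  have hi1 : Integrable (fun D => lik (1 / 2 + ε) D * (1 - u D)) ν :=
    hLa.mul_bdd (c := 1) (hum.const_sub 1).aestronglyMeasurable (ae_of_all _ fun D => by
      rw [Real.norm_eq_abs, abs_le]; constructor <;> linarith [hu0 D, hu1 D])
  have hi2 : Integrable (fun D => lik (1 / 2 - ε) D * u D) ν :=
    hLb.mul_bdd (c := 1) hum.aestronglyMeasurable (ae_of_all _ fun D => by
      rw [Real.norm_eq_abs, abs_le]; constructor <;> linarith [hu0 D, hu1 D])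
  have hLab : Integrable (fun D => lik (1 / 2 + ε) D + lik (1 / 2 - ε) D) ν := hLa.add hLb
  have hone : ∫ D, (lik (1 / 2 + ε) D + lik (1 / 2 - ε) D) ∂ν = 2 := by
    rw [hν, integral_add hLa hLb, integral_lik hW hα ha0 ha1, integral_lik hW hα hb0 hb1]
    norm_num
  set κ := (1 - 4 * ε ^ 2) ^ N with hκ
  rw [h1, h2, ← integral_add (hi1.const_mul _) (hi2.const_mul _)]
  calc ε * κ = ∫ D, 2 * ε * (κ * (1 - (lik (1 / 2 + ε) D + lik (1 / 2 - ε) D) / 4)) ∂ν := by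
        rw [integral_const_mul, integral_const_mul, integral_sub (integrable_const _)
          (hLab.div_const 4), integral_div, hone]
        simp
        ring
    _ ≤ _ := by
        refine integral_mono ((((integrable_const (1 : ℝ)).sub (hLab.div_const 4)).const_mul
          κ).const_mul (2 * ε)) ((hi1.const_mul _).add (hi2.const_mul _)) fun D => ?_
        have h := mul_tangent_le (lik_nonneg ha0 ha1 D) (lik_nonneg hb0 hb1 D) (hu0 D) (hu1 D)
        rw [lik_mul_lik] at h
        have h' := mul_le_mul_of_nonneg_left h (by positivity : 0 ≤ 2 * ε)
        simp only
        linarith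

/-- The lower bound for the minimax risk, for a known diffusion coefficient. The two parameters
differ by a small multiple of `1 / √N` in the label probability, and `N` observations do not
distinguish them reliably. -/
lemma le_minimaxExcessRisk (hW : IsPreBrownianReal W P) (hα : 0 < α) (hN : 0 < N) :
    ((3 / 32 / √N : ℝ) : EReal) ≤ minimaxExcessRisk P W N n (allRules N n)
      {θ ∈ paramSet | θ.alpha = α} := by
  refine le_iInf₂ fun g hg => ?_
  have hN1 : (1 : ℝ) ≤ N := by exact_mod_cast hN
  have hs1 : 1 ≤ √(N : ℝ) := Real.one_le_sqrt.2 hN1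
  have hs0 : 0 < √(N : ℝ) := by linarith
  set ε : ℝ := 1 / (4 * √N) with hε
  have hε0 : 0 < ε := by positivity
  have hε1 : ε < 1 / 2 := by
    rw [hε, div_lt_div_iff₀ (by positivity) (by norm_num)]
    linarith
  have hκ : 3 / 4 ≤ (1 - 4 * ε ^ 2) ^ N := by
    have h1 : 4 * ε ^ 2 = 1 / (4 * N) := by
      rw [hε, div_pow, mul_pow, Real.sq_sqrt (by positivity)]
      field_simp
    have h2 : 1 / (4 * (N : ℝ)) ≤ 1 := by
      rw [div_le_one (by positivity)]
      linarith
    have h3 := one_add_mul_le_pow (a := -(1 / (4 * (N : ℝ)))) (by linarith) N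
    have h4 : (N : ℝ) * -(1 / (4 * (N : ℝ))) = -(1 / 4) := by field_simp
    rw [h4] at h3
    rw [h1, sub_eq_add_neg]
    linarith
  have hsum := le_excessRisk_add_excessRisk hW hα hε0 hε1 hg
  have hlow : 2 * (3 / 32 / √N) ≤ ε * (1 - 4 * ε ^ 2) ^ N := by
    have h5 : 2 * (3 / 32 / √N) = ε * (3 / 4) := by rw [hε]; field_simp; norm_num
    rw [h5]
    gcongr
  rcases le_total (3 / 32 / √N) (excessRisk P W N n (coin α (1 / 2 + ε)) g) with h | h
  · exact le_iSup₂_of_le (coin α (1 / 2 + ε)) ⟨coin_mem hα (by linarith) (by linarith), rfl⟩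
      (EReal.coe_le_coe_iff.2 h)
  · exact le_iSup₂_of_le (coin α (1 / 2 - ε)) ⟨coin_mem hα (by linarith) (by linarith), rfl⟩
      (EReal.coe_le_coe_iff.2 (by linarith))

/-! ### Comparison of the minimax risks -/

lemma measurable_uncurry_classify {X : Type*} [MeasurableSpace X] {est : X → Param}
    (hmu : ∀ i, Measurable fun D => (est D).mu i) (halpha : Measurable fun D => (est D).alpha)
    (hp : ∀ i, Measurable fun D => (est D).p i) :
    Measurable fun z : X × ℝ => classify (est z.1) z.2 := by
  have hmu' : ∀ i, Measurable fun z : X × ℝ => (est z.1).mu i :=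
    fun i => (hmu i).comp measurable_fst
  have halpha' : Measurable fun z : X × ℝ => (est z.1).alpha := halpha.comp measurable_fst
  have hp' : ∀ i, Measurable fun z : X × ℝ => (est z.1).p i := fun i => (hp i).comp measurable_fst
  have hscore : ∀ i, Measurable fun z : X × ℝ => score (est z.1) i z.2 := fun i =>
    (((hmu' i).div (halpha'.pow_const 2)).mul measurable_snd).sub
      (((hmu' i).pow_const 2).div ((halpha'.pow_const 2).const_mul 2))
  have hw : ∀ i, Measurable fun z : X × ℝ => (est z.1).p i * Real.exp (score (est z.1) i z.2) :=
    fun i => (hp' i).mul (hscore i).exp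
  exact Measurable.ite (measurableSet_le measurable_const ((hw 1).div ((hw 0).add (hw 1))))
    measurable_const measurable_const

lemma plugInRules_subset_allRules (T : Set Param) : plugInRules N n T ⊆ allRules N n := by
  rintro g ⟨est, hest, hg⟩
  have h : Function.uncurry g = (fun z : Sample N n × ℝ => classify (est z.1) z.2) ∘
      fun z : Sample N n × Obs n => (z.1, z.2 (Fin.last n)) := by
    ext z
    simp [Function.uncurry, hg]
  change Measurable (Function.uncurry g)
  rw [h]
  exact (measurable_uncurry_classify hest.measurable_mu hest.measurable_alpha
    hest.measurable_p).comp (measurable_fst.prodMk ((measurable_pi_apply _).comp measurable_snd))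

lemma minimaxExcessRisk_anti {Ω : Type*} [MeasurableSpace Ω] (P : Measure Ω) (W : ℝ≥0 → Ω → ℝ)
    {R S : Set (Rule N n)} (h : R ⊆ S) (Θ : Set Param) :
    minimaxExcessRisk P W N n S Θ ≤ minimaxExcessRisk P W N n R Θ :=
  biInf_mono h

lemma minimaxExcessRisk_mono {Ω : Type*} [MeasurableSpace Ω] (P : Measure Ω) (W : ℝ≥0 → Ω → ℝ)
    (R : Set (Rule N n)) {Θ Θ' : Set Param} (h : Θ ⊆ Θ') :
    minimaxExcessRisk P W N n R Θ ≤ minimaxExcessRisk P W N n R Θ' :=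
  iInf₂_mono fun _ _ => biSup_mono h

/-- The upper bound for a known diffusion coefficient. -/
lemma minimaxExcessRisk_known_le (hW : IsPreBrownianReal W P) (hα : 0 < α) (hN : 0 < N)
    (hn : 0 < n) :
    minimaxExcessRisk P W N n (plugInRules N n {θ ∈ estimateSet | θ.alpha = α})
      {θ ∈ paramSet | θ.alpha = α} ≤ ((16 / √N : ℝ) : EReal) := by
  have hest : IsEstimator {θ ∈ estimateSet | θ.alpha = α}
      (estimator fun _ : Sample N n => α) :=
    isEstimator_estimator measurable_const fun D => ⟨estimator_mem hN (fun _ => hα) D, rfl⟩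
  refine iInf₂_le_of_le (fun D x => classify (estimator (fun _ => α) D) (x (Fin.last n)))
    ⟨_, hest, fun _ _ => rfl⟩ (iSup₂_le fun θ hθ => EReal.coe_le_coe_iff.2 ?_)
  have hα' : (θ.alpha) ≠ 0 := by rw [hθ.2]; exact hα.ne'
  have := isProbabilityMeasure_sampleLaw hW N n (paramSet_subset_estimateSet hθ.1)
  have h := excessRisk_estimator_le (K := 0) hW (paramSet_subset_estimateSet hθ.1) hN hn
    (ahat := fun _ => α) (fun _ => hα) (e := fun _ => 0)
    (fun D => by rw [← hθ.2, div_self (pow_ne_zero 2 hα')]; simp) (integrable_const _) (by simp)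
  simpa using h

/-- The upper bound for an unknown diffusion coefficient. A path observed at three times or more
suffices to estimate it at the rate `1 / √N`, whatever the drift. -/
lemma minimaxExcessRisk_unknown_le (hW : IsPreBrownianReal W P) (hN : 0 < N) (hn : 2 ≤ n) :
    minimaxExcessRisk P W N n (plugInRules N n estimateSet) paramSet
      ≤ (((16 + 4 * √chiVar) / √N : ℝ) : EReal) := by
  have hest : IsEstimator estimateSet (estimator (volatility hn : Sample N n → ℝ)) :=
    isEstimator_estimator (measurable_volatility hn) fun D =>
      estimator_mem hN (volatility_pos hn) D
  refine iInf₂_le_of_le (fun D x => classify (estimator (volatility hn) D) (x (Fin.last n)))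
    ⟨_, hest, fun _ _ => rfl⟩ (iSup₂_le fun θ hθ => EReal.coe_le_coe_iff.2 ?_)
  have hθ' := paramSet_subset_estimateSet hθ
  have h := integral_abs_quadVar_le hW hθ' hN hn
  exact excessRisk_estimator_le hW hθ' hN (by omega) (volatility_pos hn)
    (min_one_volatility_le hn θ.alpha) h.1 h.2

lemma minimaxExcessRisk_le_one (hW : IsPreBrownianReal W P) :
    minimaxExcessRisk P W N n (plugInRules N n estimateSet) paramSet ≤ ((1 : ℝ) : EReal) := by
  have hmem : coin 1 (1 / 2) ∈ estimateSet :=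
    paramSet_subset_estimateSet (coin_mem one_pos (by norm_num) (by norm_num))
  exact iInf₂_le_of_le (fun _ x => classify (coin 1 (1 / 2)) (x (Fin.last n)))
    ⟨fun _ => coin 1 (1 / 2), ⟨fun _ => hmem, fun _ => measurable_const, measurable_const,
      fun _ => measurable_const⟩, fun _ _ => rfl⟩
    (iSup₂_le fun θ hθ => EReal.coe_le_coe_iff.2
      (excessRisk_le_one hW (paramSet_subset_estimateSet hθ) _))

end Model

lemma rpow_neg_half (N : ℕ) : (N : ℝ) ^ (-1 / 2 : ℝ) = 1 / √N := by
  rw [neg_div, Real.rpow_neg (Nat.cast_nonneg N), ← Real.sqrt_eq_rpow, one_div]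

end ConstDiffusion

theorem mainTheorem3 {Ω : Type*} [MeasurableSpace Ω] (P : Measure Ω) [IsProbabilityMeasure P]
    (W : ℝ≥0 → Ω → ℝ) (hW : IsBrownianReal W P)
    (a b : ℝ) (ha : 0 < a) (hab : a ≤ b) :
    -- unknown diffusion coefficient
    (∃ c > (0 : ℝ), ∃ C > (0 : ℝ), ∀ N n : ℕ, 2 ≤ N → a * N ≤ n → (n : ℝ) ≤ b * N →
      ((c * (N : ℝ) ^ (-1 / 2 : ℝ) : ℝ) : EReal) ≤
        ConstDiffusion.minimaxExcessRisk P W N n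
          (ConstDiffusion.allRules N n) ConstDiffusion.paramSet ∧
      ConstDiffusion.minimaxExcessRisk P W N n
          (ConstDiffusion.allRules N n) ConstDiffusion.paramSet ≤
        ConstDiffusion.minimaxExcessRisk P W N n
          (ConstDiffusion.plugInRules N n ConstDiffusion.estimateSet) ConstDiffusion.paramSet ∧
      ConstDiffusion.minimaxExcessRisk P W N n
          (ConstDiffusion.plugInRules N n ConstDiffusion.estimateSet) ConstDiffusion.paramSet ≤
        ((C * (N : ℝ) ^ (-1 / 2 : ℝ) * Real.log N : ℝ) : EReal)) ∧
    -- known diffusion coefficient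
    (∀ α : ℝ, 0 < α →
      ∃ c > (0 : ℝ), ∃ C > (0 : ℝ), ∀ N n : ℕ, 1 ≤ N → a * N ≤ n → (n : ℝ) ≤ b * N →
      ((c * (N : ℝ) ^ (-1 / 2 : ℝ) : ℝ) : EReal) ≤
        ConstDiffusion.minimaxExcessRisk P W N n
          (ConstDiffusion.allRules N n)
          {θ ∈ ConstDiffusion.paramSet | θ.alpha = α} ∧
      ConstDiffusion.minimaxExcessRisk P W N n
          (ConstDiffusion.allRules N n)
          {θ ∈ ConstDiffusion.paramSet | θ.alpha = α} ≤
        ConstDiffusion.minimaxExcessRisk P W N n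
          (ConstDiffusion.plugInRules N n {θ ∈ ConstDiffusion.estimateSet | θ.alpha = α})
          {θ ∈ ConstDiffusion.paramSet | θ.alpha = α} ∧
      ConstDiffusion.minimaxExcessRisk P W N n
          (ConstDiffusion.plugInRules N n {θ ∈ ConstDiffusion.estimateSet | θ.alpha = α})
          {θ ∈ ConstDiffusion.paramSet | θ.alpha = α} ≤
        ((C * (N : ℝ) ^ (-1 / 2 : ℝ) : ℝ) : EReal)) := by
  have hB := hW.toIsPreBrownianReal
  constructor
  · have hlog2 : 0 < Real.log 2 := Real.log_pos one_lt_two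
    set C₀ : ℝ := 16 + 4 * √ConstDiffusion.chiVar + √(1 / a) with hC₀
    have hC₀pos : 0 < C₀ := by positivity
    refine ⟨3 / 32, by norm_num, C₀ / Real.log 2, by positivity, fun N n hN hna _ => ?_⟩
    have hN0 : 0 < N := by omega
    have hNr : (0 : ℝ) < N := by exact_mod_cast hN0
    refine ⟨?_, ConstDiffusion.minimaxExcessRisk_anti P W
      (ConstDiffusion.plugInRules_subset_allRules _) _, ?_⟩
    · rw [ConstDiffusion.rpow_neg_half, mul_one_div]
      exact (ConstDiffusion.le_minimaxExcessRisk hB one_pos hN0).trans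
        (ConstDiffusion.minimaxExcessRisk_mono P W _ fun θ hθ => hθ.1)
    · have hlogN : Real.log 2 ≤ Real.log N :=
        Real.log_le_log two_pos (by exact_mod_cast hN)
      have hup : C₀ / √N
          ≤ C₀ / Real.log 2 * (N : ℝ) ^ (-1 / 2 : ℝ) * Real.log N := by
        rw [ConstDiffusion.rpow_neg_half]
        calc C₀ / √N = C₀ / Real.log 2 * (1 / √N) * Real.log 2 := by field_simp
          _ ≤ _ := by gcongr
      refine le_trans ?_ (EReal.coe_le_coe_iff.2 hup)
      rcases le_or_gt 2 n with hn | hn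
      · refine (ConstDiffusion.minimaxExcessRisk_unknown_le hB hN0 hn).trans
          (EReal.coe_le_coe_iff.2 ?_)
        gcongr
        rw [hC₀]
        linarith [Real.sqrt_nonneg (1 / a)]
      · -- With at most one time step, `N ≤ 1 / a`, and the trivial bound `1` is of the right order.
        refine (ConstDiffusion.minimaxExcessRisk_le_one hB).trans (EReal.coe_le_coe_iff.2 ?_)
        have hn1 : (n : ℝ) ≤ 1 := by exact_mod_cast (by omega : n ≤ 1)
        rw [le_div_iff₀ (Real.sqrt_pos.2 hNr), one_mul]
        have h1 : √(N : ℝ) ≤ √(1 / a) := by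
          refine Real.sqrt_le_sqrt ?_
          rw [le_div_iff₀ ha]
          linarith
        rw [hC₀]
        linarith [Real.sqrt_nonneg ConstDiffusion.chiVar]
  · intro α hα
    refine ⟨3 / 32, by norm_num, 16, by norm_num, fun N n hN hna _ => ?_⟩
    have hn : 0 < n := by
      have h1 : (0 : ℝ) < a * N := mul_pos ha (by exact_mod_cast hN)
      exact_mod_cast h1.trans_le hna
    rw [ConstDiffusion.rpow_neg_half, mul_one_div, mul_one_div]
    exact ⟨ConstDiffusion.le_minimaxExcessRisk hB hα hN,
      ConstDiffusion.minimaxExcessRisk_anti P W (ConstDiffusion.plugInRules_subset_allRules _) _,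
      ConstDiffusion.minimaxExcessRisk_known_le hB hα hN hn⟩
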